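/- All graphs are finite and simple. A graph is chordal if it has no induced cycle of length at least $4$. A graph $G$ on $n$ vertices is $\epsilon$-close to a chordal graph if there is a chordal graph $H$ on the same vertex set with $|E(G)\triangle E(H)|<\epsilon n^2$. A topological tree $\mathcal T$ is the topological space described by a finite graph that is a tree (its geometric realization); its leaves are the points associated to the degree-one vertices of that graph; a subtree of $\mathcal T$ is a non-empty connected subset of $\mathcal T$. Given a graph $H$ on a vertex set $U$ and points $(x_v)_{v\in U}$ of $\mathcal T$, the graph $H$ is $(x_v)_{v\in U}$-pinned if there are subtrees $(T_v)_{v\in U}$ of $\mathcal T$ such that $x_v\in T_v$ for every $v\in U$ and, for all distinct $u,v\in U$, $uv\in E(H)$ if and only if $T_u\cap T_v\neq\varnothing$. Lemma. Let $\epsilon>0$ and let $k\ge 2$ be an integer. Fix a topological tree $\mathcal T$ with at most $k$ leaves and a set $\Gamma_0\subseteq\mathcal T$ of size at most $k$. Then for every graph $G$ on a non-empty vertex set $V$ and all values $(x_v)_{v\in V}$ in $\Gamma_0$, at least one of the following holds: - $G$ is $\epsilon$-close to a chordal graph; or - if $X$ is chosen uniformly at random among the subsets of $V$ of size $m=\lceil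 2^{40}\epsilon^{-4}k^6\ln^4 k\rceil$ (with $X=V$ if $|V|<m$), then with probability at least $\frac12$ the induced subgraph $G[X]$ is not $(x_v)_{v\in X}$-pinned. -/

import Mathlib

namespace PinnedChordal

/-- A graph is chordal if it has no induced cycle of length at least `4`. -/
def IsChordal {V : Type*} (G : SimpleGraph V) : Prop :=
  ∀ k : ℕ, 4 ≤ k → IsEmpty (SimpleGraph.cycleGraph k ↪g G)

/-- `G` is `ε`-close to a chordal graph: adding or deleting fewer than `ε n²` edges makes it
chordal (the negation of being `ε`-far, which requires at least `ε n²` modifications). -/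
def IsCloseToChordal {V : Type*} [Fintype V] (ε : ℝ) (G : SimpleGraph V) : Prop :=
  ∃ H : SimpleGraph V, IsChordal H ∧
    ((symmDiff G.edgeSet H.edgeSet).ncard : ℝ) < ε * (Fintype.card V : ℝ) ^ 2

/-- The topological space described by a finite graph: its geometric realization. A point is
given by barycentric coordinates supported on a vertex (`a = b`) or on an edge `ab`; the topology
is the one inherited from `W → ℝ`. -/
abbrev Realization {W : Type*} [Fintype W] (T : SimpleGraph W) : Type _ :=
  {p : W → ℝ // (∀ w, 0 ≤ p w) ∧ ∑ w, p w = 1 ∧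
    ∃ a b : W, (a = b ∨ T.Adj a b) ∧ ∀ w, p w ≠ 0 → w = a ∨ w = b}

/-- The leaves of a tree: the vertices of degree one. -/
def leaves {W : Type*} (T : SimpleGraph W) : Set W :=
  {w | ∃! u, T.Adj w u}

/-- A subtree of a topological tree: a nonempty connected subset. -/
def IsSubtree {P : Type*} [TopologicalSpace P] (S : Set P) : Prop :=
  IsConnected S

/-- `(S v)` is a chordal representation of `G` on the topological tree `P`. -/
def IsChordalRepresentation {V P : Type*} [TopologicalSpace P]
    (G : SimpleGraph V) (S : V → Set P) : Prop :=
  (∀ v, IsSubtree (S v)) ∧ ∀ u v, u ≠ v → (G.Adj u v ↔ (S u ∩ S v).Nonempty)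

/-- `G` is `(x v)`-pinned: it has a chordal representation `(S v)` on the topological tree `P`
with `x v ∈ S v` for every vertex `v`. -/
def IsPinned {V P : Type*} [TopologicalSpace P] (G : SimpleGraph V) (x : V → P) : Prop :=
  ∃ S : V → Set P, IsChordalRepresentation G S ∧ ∀ v, x v ∈ S v

/-- The probability that a set chosen uniformly at random among the `N`-element subsets of `V`
satisfies `Q` (used only for `N ≤ |V|`). -/
noncomputable def subsetProb {V : Type*} [Fintype V] (N : ℕ) (Q : Finset V → Prop) : ℝ :=
  ({X : Finset V | X.card = N ∧ Q X}.ncard : ℝ) / ({X : Finset V | X.card = N}.ncard : ℝ)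

/-- The query complexity `2⁴⁰ ε⁻⁴ k⁶ ln⁴ k`. -/
noncomputable def queryBound (ε : ℝ) (k : ℕ) : ℝ :=
  2 ^ 40 * (ε ^ 4)⁻¹ * (k : ℝ) ^ 6 * Real.log (k : ℝ) ^ 4

/-- The number of sampled vertices: the query complexity rounded up, or all of `V` when `V` has
fewer vertices than that. -/
noncomputable def sampleSize (V : Type*) [Fintype V] (ε : ℝ) (k : ℕ) : ℕ :=
  min ⌈queryBound ε k⌉₊ (Fintype.card V)

end PinnedChordal

/-!
The proof predicts the whole graph `G` from a small part of the sample, and tests the prediction on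
the rest of it.

*Combinatorial form.* Root the tree. Its points form a semilattice in which the elements below a
given one are a chain (`exists_isTreeOrder`); connected sets become order-convex sets and,
after shrinking, subtrees with a top. Two such subtrees meet iff one contains the top of the other,
and whether they do is decided by the top `t u` of each, which lies on the root path to its pin,
and by the last point `b u γ` that is reached on each root path (`PinnedRep.adj_of_le`,
`PinnedRep.t_le_b`). There are at most `k` root paths, hence `k` chains to look at.

*Copying.* Let a sample `y` with a representation be given. A further vertex `u` is described by its
pin and its sampled neighbours. It receives as new top the lowest top of a sampled subtree with the
same pin that is compatible with this description (or any compatible point, if there is none), and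
its new subtree extends downwards until it meets the top of a sampled non-neighbour. The resulting
graph is the intersection graph of rooted subtrees, so it is chordal
(`PinnedRep.isChordal_predicted`). If the sample together with `u` and `v` has a representation that
extends the given one, the prediction for `u` and `v` is correct unless one of them is extremal, in
one of three senses defined by the other, compared with the sampled elements that share its pin
(`PinnedRep.predictedAdj_iff_adj`). Among any `s + 1` elements at most one per pin is extremal in
each sense, so an exchange argument bounds the probability of an error by `6 k / (s + 1)`, where `s`
is the size of the sample (`card_perm_not_isWitnessed_le`, `card_perm_mispredicted_le`).

*Union bound.* The prediction depends only on the order of at most `3 s k` distinguished points,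
so there are at most `2 ^ (9 s² k²)` predictions for a given sample. Each chordal one is wrong at an
`ε` fraction of all pairs if `G` is `ε`-far from chordal, so among `t` independent random test pairs
it is wrong at a fraction `ε / 4` or less with probability exponentially small in `ε t`
(`card_few_hits_le`). With `s` of order `k / ε` and `t` of order `s² k² / ε`, all chordal
predictions fail together with probability at least `3 / 4` (`card_hasGoodPrediction_le`), whereas
for a representable family at least half of its rearrangements have a good prediction, by Markov's
inequality (`card_perm_le_two_mul`).

These estimates are for independent random vertices. A set that is pinned stays so on every family
of its elements, which carries the bound over to random sets of the prescribed size
(`card_subsets_mul_le`).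
-/

namespace PinnedChordal

/-! ### Rooted subtrees of tree-like orders -/

/-- A partial order is tree-like if any two elements with a common upper bound are comparable:
the elements below a given one are the points of the path to it from the root. -/
def TreeLike (P : Type*) [LE P] : Prop :=
  ∀ ⦃a b c : P⦄, a ≤ c → b ≤ c → a ≤ b ∨ b ≤ a

/-- `S` is a subtree with topmost point `t`, where smaller means closer to the root. -/
structure IsRootedSubtree {P : Type*} [LE P] (t : P) (S : Set P) : Prop where
  top_mem : t ∈ S
  top_le : ∀ p ∈ S, t ≤ p
  convex : ∀ p ∈ S, ∀ q, t ≤ q → q ≤ p → q ∈ S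

/-- Intersection graphs of rooted subtrees are chordal: on a cycle, the vertex whose subtree has
its topmost point farthest from the root has adjacent neighbours. -/
theorem isChordal_of_isRootedSubtree {V P : Type*} [PartialOrder P] (hP : TreeLike P)
    (τ : V → P) (S : V → Set P) (hS : ∀ v, IsRootedSubtree (τ v) (S v)) (H : SimpleGraph V)
    (hH : ∀ u v, u ≠ v → (H.Adj u v ↔ τ u ∈ S v ∨ τ v ∈ S u)) : IsChordal H := by
  intro k hk
  refine ⟨fun f => ?_⟩
  obtain ⟨n, rfl⟩ : ∃ n, k = n + 4 := ⟨k - 4, by omega⟩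
  obtain ⟨i, -, hi⟩ := Finset.univ.exists_maximalFor (fun j => τ (f j))
    (Finset.univ_nonempty (α := Fin (n + 4)))
  have hmax : ∀ j, τ (f i) ≤ τ (f j) → τ (f j) ≤ τ (f i) := fun j => hi (Finset.mem_univ j)
  have key : ∀ j, (SimpleGraph.cycleGraph (n + 4)).Adj i j → τ (f i) ∈ S (f j) := by
    intro j hj
    have h1 : H.Adj (f i) (f j) := f.map_rel_iff.2 hj
    rcases (hH _ _ h1.ne).1 h1 with h | h
    · exact h
    · have h2 := (hS _).top_le _ h
      rw [le_antisymm h2 (hmax j h2)]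
      exact (hS _).top_mem
  have e1 := key (i + 1) (by rw [SimpleGraph.cycleGraph_adj]; right; simp)
  have e2 := key (i - 1) (by rw [SimpleGraph.cycleGraph_adj]; left; simp)
  have h4 : i + 1 - (i - 1) = 1 + 1 := by abel
  have h6 : ((1 : Fin (n + 4)) + 1).val = 2 := by
    rw [Fin.val_add, Fin.val_one, Nat.mod_eq_of_lt (by omega)]
  have hne : i + 1 ≠ i - 1 := by
    intro h
    rw [h, sub_self] at h4
    rw [← h4] at h6
    simp at h6
  have hadj : (SimpleGraph.cycleGraph (n + 4)).Adj (i + 1) (i - 1) := by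
    rw [← f.map_rel_iff]
    refine (hH _ _ (fun h => hne (f.injective h))).2 ?_
    rcases hP ((hS _).top_le _ e1) ((hS _).top_le _ e2) with h | h
    · right; exact (hS _).convex _ e1 _ h ((hS _).top_le _ e2)
    · left; exact (hS _).convex _ e2 _ h ((hS _).top_le _ e1)
  rw [SimpleGraph.cycleGraph_adj'] at hadj
  have h5 : i - 1 - (i + 1) = -(1 + 1) := by abel
  rw [h4, h5, Fin.val_neg', h6, Nat.mod_eq_of_lt (by omega)] at hadj
  omega

/-- A representation of the reflexive relation `A` on `I` by subtrees of a tree-like order `P`,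
the subtree of `i` being pinned at the point `e (x i)`. The point `b i γ` is the last point
of the path from the root to `e γ` that lies above a point of the subtree of `i`. -/
structure PinnedRep {I Γ P : Type*} [LE P] (A : I → I → Prop) (x : I → Γ) (e : Γ → P) where
  t : I → P
  S : I → Set P
  b : I → Γ → P
  sub : ∀ i, IsRootedSubtree (t i) (S i)
  pin : ∀ i, e (x i) ∈ S i
  adj : ∀ i j, A i j ↔ t i ∈ S j ∨ t j ∈ S i
  b_le : ∀ i γ, b i γ ≤ e γ
  b_below : ∀ i γ, ∃ p ∈ S i, b i γ ≤ p
  le_b : ∀ i γ, ∀ p ∈ S i, ∀ q, q ≤ e γ → q ≤ p → q ≤ b i γ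

namespace PinnedRep

variable {I Γ P : Type*} [PartialOrder P] {A : I → I → Prop} {x : I → Γ} {e : Γ → P}

theorem symm (ρ : PinnedRep A x e) {i j : I} (h : A i j) : A j i :=
  (ρ.adj j i).2 ((ρ.adj i j).1 h).symm

theorem t_le (ρ : PinnedRep A x e) (i : I) : ρ.t i ≤ e (x i) :=
  (ρ.sub i).top_le _ (ρ.pin i)

theorem t_le_b (ρ : PinnedRep A x e) {i j : I} (h : A i j) : ρ.t i ≤ ρ.b j (x i) := by
  rcases (ρ.adj i j).1 h with h | h
  · exact ρ.le_b _ _ _ h _ (ρ.t_le i) le_rfl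
  · exact ρ.le_b _ _ _ (ρ.sub j).top_mem _ (ρ.t_le i) ((ρ.sub i).top_le _ h)

/-- Two subtrees meet if each reaches, along its own root path, down to the other. -/
theorem adj_of_le (hP : TreeLike P) (ρ : PinnedRep A x e) {i j : I}
    (h1 : ρ.t i ≤ ρ.b j (x i)) (h2 : ρ.t j ≤ ρ.b i (x j)) : A i j := by
  obtain ⟨p, hp, hbp⟩ := ρ.b_below j (x i)
  obtain ⟨q, hq, hbq⟩ := ρ.b_below i (x j)
  rw [ρ.adj]
  rcases hP (h1.trans hbp) ((ρ.sub j).top_le _ hp) with h | h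
  · right; exact (ρ.sub i).convex _ hq _ h (h2.trans hbq)
  · left; exact (ρ.sub j).convex _ hp _ h (h1.trans hbp)

/-- If the root path to the pin of `i` passes through the top of `j`, one inequality suffices. -/
theorem adj_of_le_of_le (hP : TreeLike P) (ρ : PinnedRep A x e) {i j : I}
    (h1 : ρ.t i ≤ ρ.b j (x i)) (h2 : ρ.t j ≤ e (x i)) : A i j := by
  obtain ⟨p, hp, hbp⟩ := ρ.b_below j (x i)
  rw [ρ.adj]
  rcases hP (h1.trans hbp) ((ρ.sub j).top_le _ hp) with h | h
  · right; exact (ρ.sub i).convex _ (ρ.pin i) _ h h2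
  · left; exact (ρ.sub j).convex _ hp _ h (h1.trans hbp)

/-- A point above a point of the subtree of `j` lies above its top or in the subtree. -/
theorem le_or_mem (hP : TreeLike P) (ρ : PinnedRep A x e) {j : I} {γ : Γ} {q : P}
    (h : q ≤ ρ.b j γ) : q ≤ ρ.t j ∨ ρ.t j ≤ q ∧ q ∈ ρ.S j := by
  obtain ⟨p, hp, hbp⟩ := ρ.b_below j γ
  rcases hP (h.trans hbp) ((ρ.sub j).top_le _ hp) with h' | h'
  · exact Or.inl h'
  · exact Or.inr ⟨h', (ρ.sub j).convex _ hp _ h' (h.trans hbp)⟩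

end PinnedRep

/-! ### Extending a representation of a sample -/

/-- Names for the points that a representation of a sample `J` distinguishes: the top of a
sampled subtree, the pin `γ` as `(none, γ)`, and the last point `b j γ` as `(some j, γ)`. -/
abbrev SamplePoint (J Γ : Type*) := J ⊕ (Option J × Γ)

section Rule

variable {J Γ : Type*} (d : SamplePoint J Γ → SamplePoint J Γ → Prop) (cls : J → Γ) (c : Γ)
  (N : Set J)

/-- The point `q` can be the topmost point of a subtree pinned at `c` whose owner has the set
`N` of sampled neighbours, as far as the root path to `c` is concerned. The relation `d` is the
order of the distinguished points. -/
def IsValidTop (q : SamplePoint J Γ) : Prop :=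
  d q (Sum.inr (none, c)) ∧ (∀ j ∈ N, d q (Sum.inr (some j, c))) ∧
    ∀ j ∉ N, d (Sum.inl j) (Sum.inr (none, c)) → ¬ d q (Sum.inr (some j, c))

/-- The copying rule: the chosen point is valid, and if the top of some sampled subtree
with the same pin is valid, then it is the lowest such top. -/
def IsCopiedTop (q : SamplePoint J Γ) : Prop :=
  IsValidTop d c N q ∧ ∀ j, cls j = c → IsValidTop d c N (Sum.inl j) →
    d (Sum.inl j) q ∧ ∃ j', cls j' = c ∧ q = Sum.inl j'

open Classical in
/-- The topmost point given by the copying rule (the pin itself if the rule cannot be met). -/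
noncomputable def copiedTop : SamplePoint J Γ :=
  if h : ∃ q, IsCopiedTop d cls c N q then h.choose else Sum.inr (none, c)

/-- The point `p` lies in the subtree that has topmost point `q` and extends downwards until it
meets the top of a sampled subtree outside `N`. -/
def ReachedFrom (q p : SamplePoint J Γ) : Prop :=
  d q p ∧ ∀ j ∉ N, d q (Sum.inl j) → d (Sum.inl j) p → d (Sum.inl j) q

/-- Adjacency predicted from the order `d` of the distinguished points for two vertices with
pins `c`, `c'` and sampled neighbourhoods `N`, `N'`. -/
def PredictedAdj (c' : Γ) (N' : Set J) : Prop :=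
  ReachedFrom d N' (copiedTop d cls c' N') (copiedTop d cls c N) ∨
    ReachedFrom d N (copiedTop d cls c N) (copiedTop d cls c' N')

theorem predictedAdj_comm (c' : Γ) (N' : Set J) :
    PredictedAdj d cls c N c' N' ↔ PredictedAdj d cls c' N' c N := by
  unfold PredictedAdj; exact or_comm

end Rule

section Sample

variable {I J Γ P : Type*} [PartialOrder P] {A : I → I → Prop} {x : I → Γ} {e : Γ → P}

/-- The distinguished points of a representation of the sample `y`. -/
def PinnedRep.point (ρ : PinnedRep A x e) (y : J → I) : SamplePoint J Γ → P
  | Sum.inl j => ρ.t (y j)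
  | Sum.inr (none, γ) => e γ
  | Sum.inr (some j, γ) => ρ.b (y j) γ

/-- The order of the distinguished points. -/
def PinnedRep.order (ρ : PinnedRep A x e) (y : J → I) (p q : SamplePoint J Γ) : Prop :=
  ρ.point y p ≤ ρ.point y q

/-- Every graph predicted from an actual order of points is chordal. -/
theorem PinnedRep.isChordal_predicted {V : Type*} (hP : TreeLike P) (ρ : PinnedRep A x e)
    (y : J → I) (cls : J → Γ) (xV : V → Γ) (N : V → Set J) (H : SimpleGraph V)
    (hH : ∀ u v, u ≠ v →
      (H.Adj u v ↔ PredictedAdj (ρ.order y) cls (xV u) (N u) (xV v) (N v))) :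
    IsChordal H := by
  set τ : V → P := fun v => ρ.point y (copiedTop (ρ.order y) cls (xV v) (N v)) with hτ
  refine isChordal_of_isRootedSubtree hP τ
    (fun v => {p | τ v ≤ p ∧ ∀ j ∉ N v, τ v ≤ ρ.t (y j) → ρ.t (y j) ≤ p → ρ.t (y j) ≤ τ v})
    (fun v => ⟨⟨le_rfl, fun _ _ _ h => h⟩, fun p hp => hp.1, fun p hp q hq hqp =>
      ⟨hq, fun j hj h1 h2 => hp.2 j hj h1 (h2.trans hqp)⟩⟩) H (fun u v huv => ?_)
  rw [hH u v huv]
  rfl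

/-- The element `v` is not isolated by the sample `y`, relative to a property `C` and a
comparison `R` among elements with the same pin: if it has the property, then so does a
sampled element with the same pin that stands in relation `R` to it. -/
def IsWitnessed (x : I → Γ) (C : I → Prop) (R : I → I → Prop) (y : J → I) (v : I) : Prop :=
  C v → ∃ j, x (y j) = x v ∧ C (y j) ∧ R (y j) v

namespace PinnedRep

/-- The sample contains elements close enough to `v` on three scales seen from `u`: tops below the
reach of the subtree of `u`, reaches of neighbours of `u`, and tops above the pin of `u`. -/
structure IsWellSampled (ρ : PinnedRep A x e) (y : J → I) (u v : I) : Prop where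
  beyond : IsWitnessed x (fun w => ¬ ρ.t w ≤ ρ.b u (x w)) (fun w w' => ρ.t w ≤ ρ.t w') y v
  reach : IsWitnessed x (fun w => A u w) (fun w w' => ρ.b w (x u) ≤ ρ.b w' (x u)) y v
  above : IsWitnessed x (fun w => ρ.t w ≤ e (x u)) (fun w w' => ρ.t w' ≤ ρ.t w) y v

/-- `p` is a possible top for `u`, as far as the root path to the pin of `u` and the sample `y`
can tell. -/
def ValidAt (ρ : PinnedRep A x e) (y : J → I) (u : I) (p : P) : Prop :=
  p ≤ e (x u) ∧ (∀ j, A u (y j) → p ≤ ρ.b (y j) (x u)) ∧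
    ∀ j, ¬ A u (y j) → ρ.t (y j) ≤ e (x u) → ¬ p ≤ ρ.b (y j) (x u)

theorem ValidAt.ordConnected {ρ : PinnedRep A x e} {y : J → I} {u : I} {p q r : P}
    (hp : ρ.ValidAt y u p) (hr : ρ.ValidAt y u r) (hpq : p ≤ q) (hqr : q ≤ r) :
    ρ.ValidAt y u q :=
  ⟨hqr.trans hr.1, fun j hj => hqr.trans (hr.2.1 j hj),
    fun j hj h1 h2 => hp.2.2 j hj h1 (hpq.trans h2)⟩

/-- The true top of `u` is valid. -/
theorem validAt_t (hP : TreeLike P) (ρ : PinnedRep A x e) (y : J → I) (u : I) :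
    ρ.ValidAt y u (ρ.t u) :=
  ⟨ρ.t_le u, fun _ hj => ρ.t_le_b hj, fun _ hj h1 h2 => hj (ρ.adj_of_le_of_le hP h2 h1)⟩

theorem exists_isCopiedTop [Finite J] (hP : TreeLike P) (ρ : PinnedRep A x e) (y : J → I)
    (u : I) : ∃ q, IsCopiedTop (ρ.order y) (x ∘ y) (x u) {j | A u (y j)} q := by
  by_cases hne : {j | x (y j) = x u ∧ ρ.ValidAt y u (ρ.t (y j))}.Nonempty
  · obtain ⟨j, hj, hmax⟩ := Set.Finite.exists_maximalFor (fun j => ρ.t (y j)) _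
      (Set.toFinite _) hne
    refine ⟨Sum.inl j, hj.2, fun j' h1 h2 => ⟨?_, j, hj.1, rfl⟩⟩
    have h2' : ρ.ValidAt y u (ρ.t (y j')) := h2
    rcases hP h2'.1 hj.2.1 with h | h
    · exact h
    · exact hmax ⟨h1, h2'⟩ h
  · -- no sampled top is valid: take the lowest upper bound that the sampled neighbours impose
    obtain ⟨q, hq, hmin⟩ := Set.Finite.exists_minimalFor (fun q => ρ.point y q)
      (insert (Sum.inr (none, x u))
        ((fun j => (Sum.inr (some j, x u) : SamplePoint J Γ)) '' {j | A u (y j)}))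
      (Set.toFinite _) ⟨_, Set.mem_insert _ _⟩
    have hqe : ρ.point y q ≤ e (x u) := by
      rcases hq with rfl | ⟨j, -, rfl⟩
      · exact le_rfl
      · exact ρ.b_le _ _
    have htq : ρ.t u ≤ ρ.point y q := by
      rcases hq with rfl | ⟨j, hj, rfl⟩
      · exact ρ.t_le u
      · exact ρ.t_le_b hj
    refine ⟨q, ⟨hqe, fun j hj => ?_, fun j hj h1 h2 => ?_⟩, fun j h1 h2 => ?_⟩
    · rcases hP hqe (ρ.b_le (y j) (x u)) with h | h
      · exact h
      · exact hmin (Set.mem_insert_of_mem _ ⟨j, hj, rfl⟩) h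
    · exact (ρ.validAt_t hP y u).2.2 j hj h1 (htq.trans h2)
    · exact (hne ⟨j, h1, h2⟩).elim

theorem copiedTop_spec [Finite J] (hP : TreeLike P) (ρ : PinnedRep A x e) (y : J → I) (u : I) :
    IsCopiedTop (ρ.order y) (x ∘ y) (x u) {j | A u (y j)}
      (copiedTop (ρ.order y) (x ∘ y) (x u) {j | A u (y j)}) := by
  have h := ρ.exists_isCopiedTop hP y u
  rw [copiedTop, dif_pos h]
  exact h.choose_spec

/-- The top assigned to `u` by the copying rule. -/
noncomputable def newTop (ρ : PinnedRep A x e) (y : J → I) (u : I) : P :=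
  ρ.point y (copiedTop (ρ.order y) (x ∘ y) (x u) {j | A u (y j)})

theorem validAt_newTop [Finite J] (hP : TreeLike P) (ρ : PinnedRep A x e) (y : J → I) (u : I) :
    ρ.ValidAt y u (ρ.newTop y u) :=
  (ρ.copiedTop_spec hP y u).1

theorem le_newTop [Finite J] (hP : TreeLike P) (ρ : PinnedRep A x e) (y : J → I) {u : I} {j : J}
    (hj : x (y j) = x u) (h : ρ.ValidAt y u (ρ.t (y j))) : ρ.t (y j) ≤ ρ.newTop y u :=
  ((ρ.copiedTop_spec hP y u).2 j hj h).1

theorem newTop_eq [Finite J] (hP : TreeLike P) (ρ : PinnedRep A x e) (y : J → I) {u : I} {j : J}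
    (hj : x (y j) = x u) (h : ρ.ValidAt y u (ρ.t (y j))) :
    ∃ j', x (y j') = x u ∧ ρ.newTop y u = ρ.t (y j') := by
  obtain ⟨j', h1, h2⟩ := ((ρ.copiedTop_spec hP y u).2 j hj h).2
  exact ⟨j', h1, by rw [newTop, h2]; rfl⟩

/-- `v` is predicted to contain the new top of `u`. -/
def Reaches (ρ : PinnedRep A x e) (y : J → I) (v u : I) : Prop :=
  ρ.newTop y v ≤ ρ.newTop y u ∧ ∀ j, ¬ A v (y j) → ρ.newTop y v ≤ ρ.t (y j) →
    ρ.t (y j) ≤ ρ.newTop y u → ρ.t (y j) ≤ ρ.newTop y v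

theorem predictedAdj_iff (ρ : PinnedRep A x e) (y : J → I) (u v : I) :
    PredictedAdj (ρ.order y) (x ∘ y) (x u) {j | A u (y j)} (x v) {j | A v (y j)} ↔
      ρ.Reaches y v u ∨ ρ.Reaches y u v :=
  Iff.rfl

/-- No edge is invented at a well-sampled pair. -/
theorem adj_of_reaches [Finite J] (hP : TreeLike P) (ρ : PinnedRep A x e) (y : J → I) {u v : I}
    (huv : ρ.IsWellSampled y u v) (hvu : ρ.IsWellSampled y v u) (h : ρ.Reaches y v u) :
    A u v := by
  by_contra hA
  have hu := ρ.validAt_newTop hP y u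
  have hv := ρ.validAt_newTop hP y v
  have hv_le : ρ.newTop y v ≤ e (x u) := h.1.trans hu.1
  by_cases h1 : ρ.t u ≤ ρ.b v (x u)
  · have h2 : ¬ ρ.t v ≤ ρ.b u (x v) := fun h2 => hA (ρ.adj_of_le hP h1 h2)
    obtain ⟨j, hj, hC, hR⟩ := huv.beyond h2
    rw [hj] at hC
    have h3 : ρ.newTop y v ≤ ρ.b u (x v) := ρ.le_b _ _ _ (ρ.pin u) _ hv.1 hv_le
    have h4 : ρ.b u (x v) ≤ ρ.t (y j) :=
      (hP (hR.trans (ρ.t_le v)) (ρ.b_le u (x v))).resolve_left hC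
    exact hC ((ρ.le_newTop hP y hj
      (hv.ordConnected (ρ.validAt_t hP y v) (h3.trans h4) hR)).trans h3)
  · obtain ⟨j, hj, hC, hR⟩ := hvu.beyond h1
    rw [hj] at hC
    -- the sampled subtree with top between the reach of `v` and the top of `u` blocks `v`
    have hAj : ¬ A v (y j) := fun hvj => hC (hj ▸ ρ.t_le_b (ρ.symm hvj))
    have h3 : ρ.newTop y v ≤ ρ.b v (x u) := ρ.le_b _ _ _ (ρ.pin v) _ hv_le hv.1
    have h4 : ρ.b v (x u) ≤ ρ.t (y j) :=
      (hP (hR.trans (ρ.t_le u)) (ρ.b_le v (x u))).resolve_left hC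
    have h5 : ¬ ρ.t (y j) ≤ ρ.newTop y u := fun h5 =>
      hC ((h.2 j hAj (h3.trans h4) h5).trans h3)
    have h6 : ρ.newTop y u ≤ ρ.t (y j) :=
      (hP (hR.trans (ρ.t_le u)) hu.1).resolve_left h5
    exact h5 (ρ.le_newTop hP y hj (hu.ordConnected (ρ.validAt_t hP y u) h6 hR))

/-- The new top of `u` is within reach of each of its well-sampled neighbours. -/
theorem newTop_le_b [Finite J] (hP : TreeLike P) (ρ : PinnedRep A x e) (y : J → I) {u v : I}
    (huv : ρ.IsWellSampled y u v) (hA : A u v) : ρ.newTop y u ≤ ρ.b v (x u) := by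
  obtain ⟨j, -, hC, hR⟩ := huv.reach hA
  exact ((ρ.validAt_newTop hP y u).2.1 j hC).trans hR

/-- If the new top of `v` is off the root path to the pin of `u`, then it is copied. -/
theorem exists_eq_of_not_le [Finite J] (hP : TreeLike P) (ρ : PinnedRep A x e) (y : J → I)
    {u v : I} (huv : ρ.IsWellSampled y u v) (hle : ρ.t v ≤ e (x u))
    (h : ¬ ρ.newTop y v ≤ e (x u)) : ∃ j, x (y j) = x v ∧ ρ.newTop y v = ρ.t (y j) := by
  obtain ⟨j, hj, hC, hR⟩ := huv.above hle
  have hv := ρ.validAt_newTop hP y v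
  have h1 : ρ.t (y j) ≤ ρ.newTop y v :=
    (hP (hj ▸ ρ.t_le (y j)) hv.1).resolve_right fun h' => h (h'.trans hC)
  exact ρ.newTop_eq hP y hj ((ρ.validAt_t hP y v).ordConnected hv hR h1)

/-- If the new top of `v` lies beyond the point where the root paths to the pins of `u` and `v`
branch, then the top of `u` does not, because its subtree reaches the new top of `v`. -/
theorem t_le_of_newTop_not_le [Finite J] (hP : TreeLike P) (ρ : PinnedRep A x e) (y : J → I)
    {u v : I} (hvu : ρ.IsWellSampled y v u) (hA : A u v) (h : ¬ ρ.newTop y v ≤ e (x u)) :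
    ρ.t u ≤ e (x v) := by
  rcases ρ.le_or_mem hP (ρ.newTop_le_b hP y hvu (ρ.symm hA)) with h' | h'
  · exact (h (h'.trans (ρ.t_le u))).elim
  · exact h'.1.trans (ρ.validAt_newTop hP y v).1

/-- The new tops of a well-sampled adjacent pair are comparable. Copying is what makes this true:
otherwise both tops would be copied from sampled elements beyond the branching point of the
two root paths, and the one copied by `u` would be a neighbour of `v` not reached by its
new top. -/
theorem newTop_comparable [Finite J] (hP : TreeLike P) (ρ : PinnedRep A x e) (y : J → I)
    {u v : I} (huv : ρ.IsWellSampled y u v) (hvu : ρ.IsWellSampled y v u) (hA : A u v) :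
    ρ.newTop y u ≤ ρ.newTop y v ∨ ρ.newTop y v ≤ ρ.newTop y u := by
  have hu := ρ.validAt_newTop hP y u
  have hv := ρ.validAt_newTop hP y v
  by_cases h1 : ρ.newTop y v ≤ e (x u)
  · exact hP hu.1 h1
  by_cases h2 : ρ.newTop y u ≤ e (x v)
  · exact hP h2 hv.1
  have htu := ρ.t_le_of_newTop_not_le hP y hvu hA h1
  have htv := ρ.t_le_of_newTop_not_le hP y huv (ρ.symm hA) h2
  obtain ⟨j, hj, hju⟩ := ρ.exists_eq_of_not_le hP y hvu htu h2
  have h3 := ρ.newTop_le_b hP y huv hA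
  have hAj : A v (y j) := by
    rcases ρ.le_or_mem hP h3 with h | h
    · exact (h2 (h.trans (ρ.t_le v))).elim
    · rw [ρ.adj]; right; rw [← hju]; exact h.2
  rcases ρ.le_or_mem hP (hv.2.1 j hAj) with h | h
  · exact (h1 (h.trans (hj ▸ ρ.t_le (y j)))).elim
  · exact (h2 (hju ▸ h.1.trans hv.1)).elim

/-- No edge is lost at a well-sampled pair with comparable new tops. -/
theorem reaches_of_adj [Finite J] (hP : TreeLike P) (ρ : PinnedRep A x e) (y : J → I) {u v : I}
    (huv : ρ.IsWellSampled y u v) (hA : A u v)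
    (hle : ρ.newTop y v ≤ ρ.newTop y u) : ρ.Reaches y v u := by
  refine ⟨hle, fun j hj h1 h2 => ?_⟩
  rcases ρ.le_or_mem hP (h2.trans (ρ.newTop_le_b hP y huv hA)) with h | h
  · have h3 := h.trans (ρ.t_le v)
    exact ((ρ.validAt_newTop hP y v).2.2 j hj h3
      (h1.trans (ρ.le_b _ _ _ (ρ.sub _).top_mem _ h3 le_rfl))).elim
  · exact (hj ((ρ.adj _ _).2 (Or.inr h.2))).elim

/-- At a well-sampled pair the prediction agrees with the represented relation. -/
theorem predictedAdj_iff_adj [Finite J] (hP : TreeLike P) (ρ : PinnedRep A x e) (y : J → I)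
    {u v : I} (huv : ρ.IsWellSampled y u v) (hvu : ρ.IsWellSampled y v u) :
    PredictedAdj (ρ.order y) (x ∘ y) (x u) {j | A u (y j)} (x v) {j | A v (y j)} ↔ A u v := by
  rw [predictedAdj_iff]
  constructor
  · rintro (h | h)
    · exact ρ.adj_of_reaches hP y huv hvu h
    · exact ρ.symm (ρ.adj_of_reaches hP y hvu huv h)
  · intro hA
    rcases ρ.newTop_comparable hP y huv hvu hA with h | h
    · exact Or.inr (ρ.reaches_of_adj hP y hvu (ρ.symm hA) h)
    · exact Or.inl (ρ.reaches_of_adj hP y huv hA h)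

end PinnedRep

end Sample

/-! ### Representations from convex sets -/

/-- Finitely many convex sets in a tree-like semilattice can be replaced by subtrees with a top
without changing which pairs meet: keep one common point of each meeting pair, and the pins. -/
theorem exists_pinnedRep {I Γ P : Type*} [Finite I] [SemilatticeInf P] (hP : TreeLike P)
    (A : I → I → Prop) (x : I → Γ) (e : Γ → P) (C : I → Set P)
    (hC : ∀ i, ∀ a ∈ C i, ∀ b ∈ C i, ∀ f, a ⊓ b ≤ f → f ≤ a → f ∈ C i)
    (hpin : ∀ i, e (x i) ∈ C i) (hadj : ∀ i j, A i j ↔ (C i ∩ C j).Nonempty) :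
    Nonempty (PinnedRep A x e) := by
  classical
  have := Fintype.ofFinite I
  have h0 : ∀ i j, ∃ w, A i j → w ∈ C i ∧ w ∈ C j := by
    intro i j
    by_cases h : A i j
    · obtain ⟨w, hw⟩ := (hadj i j).1 h
      exact ⟨w, fun _ => hw⟩
    · exact ⟨e (x i), fun h' => (h h').elim⟩
  choose w hw using h0
  have hF0 : ∀ i, ∃ F : Finset P, (∀ p ∈ F, p ∈ C i) ∧ e (x i) ∈ F ∧ (∀ j, A i j → w i j ∈ F) ∧
      ∀ j, A j i → w j i ∈ F := by
    intro i
    refine ⟨insert (e (x i)) ((Finset.univ.filter (fun j => A i j)).image (w i) ∪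
      (Finset.univ.filter (fun j => A j i)).image (fun j => w j i)), ?_, by simp, ?_, ?_⟩
    · intro p hp
      simp only [Finset.mem_insert, Finset.mem_union, Finset.mem_image, Finset.mem_filter,
        Finset.mem_univ, true_and] at hp
      rcases hp with rfl | ⟨j, hj, rfl⟩ | ⟨j, hj, rfl⟩
      · exact hpin i
      · exact (hw i j hj).1
      · exact (hw j i hj).2
    · intro j hj
      simp only [Finset.mem_insert, Finset.mem_union, Finset.mem_image, Finset.mem_filter,
        Finset.mem_univ, true_and]
      exact Or.inr (Or.inl ⟨j, hj, rfl⟩)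
    · intro j hj
      simp only [Finset.mem_insert, Finset.mem_union, Finset.mem_image, Finset.mem_filter,
        Finset.mem_univ, true_and]
      exact Or.inr (Or.inr ⟨j, hj, rfl⟩)
  choose F hFC hFe hFw hFw' using hF0
  set t : I → P := fun i => (F i).inf' ⟨_, hFe i⟩ id with ht
  have htC : ∀ i, t i ∈ C i := fun i =>
    Finset.inf'_induction (p := fun p => p ∈ C i) _ _
      (fun a ha b hb => hC i a ha b hb _ le_rfl inf_le_left) (fun b hb => hFC i b hb)
  have htF : ∀ i, ∀ p ∈ F i, t i ≤ p := fun i p hp => Finset.inf'_le id hp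
  set S : I → Set P := fun i => {f | t i ≤ f ∧ ∃ p ∈ F i, f ≤ p} with hS
  have hSC : ∀ i, S i ⊆ C i := by
    rintro i f ⟨h1, p, hp, h2⟩
    exact hC i p (hFC i p hp) (t i) (htC i) f (inf_le_right.trans h1) h2
  have hb0 : ∀ i γ, ∃ b : P, b ≤ e γ ∧ (∃ p ∈ S i, b ≤ p) ∧
      ∀ p ∈ S i, ∀ q, q ≤ e γ → q ≤ p → q ≤ b := by
    intro i γ
    obtain ⟨p, hp, hmax⟩ := (F i).exists_maximalFor (fun p => e γ ⊓ p) ⟨_, hFe i⟩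
    refine ⟨e γ ⊓ p, inf_le_left, ⟨p, ⟨htF i p hp, p, hp, le_rfl⟩, inf_le_right⟩, ?_⟩
    rintro f ⟨-, p', hp', hfp⟩ q hq1 hq2
    have h1 : q ≤ e γ ⊓ p' := le_inf hq1 (hq2.trans hfp)
    rcases hP (inf_le_left : e γ ⊓ p' ≤ _) (inf_le_left : e γ ⊓ p ≤ _) with h | h
    · exact h1.trans h
    · exact h1.trans (hmax hp' h)
  choose b hb1 hb2 hb3 using hb0
  have htS : ∀ i, t i ∈ S i := fun i => ⟨le_rfl, _, hFe i, htF i _ (hFe i)⟩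
  refine ⟨⟨t, S, b, fun i => ⟨htS i, fun p hp => hp.1, ?_⟩, fun i => ⟨htF i _ (hFe i), _, hFe i,
    le_rfl⟩, fun i j => ⟨fun h => ?_, fun h => ?_⟩, hb1, hb2, hb3⟩⟩
  · rintro p ⟨-, p', hp', hpp⟩ q h1 h2
    exact ⟨h1, p', hp', h2.trans hpp⟩
  · have h1 := htF i _ (hFw i j h)
    have h2 := htF j _ (hFw' j i h)
    rcases hP h1 h2 with h3 | h3
    · right; exact ⟨h3, _, hFw i j h, h2⟩
    · left; exact ⟨h3, _, hFw' j i h, h1⟩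
  · rw [hadj]
    rcases h with h | h
    · exact ⟨_, htC i, hSC j h⟩
    · exact ⟨_, hSC i h, htC j⟩

/-! ### Points of a rooted tree as functions on its vertices -/

section TreeFun

variable {W : Type*} [PartialOrder W]

/-- The functions that describe points of a tree whose vertices are ordered from the root `r`: the
value at `w ≠ r` is the fraction of the edge above `w` that is covered by the path from `r` to
the point, and the value at `r` is `1`. The value at the root is not prescribed here. -/
def IsTreeFun (f : W → ℝ) : Prop :=
  (∀ w, 0 ≤ f w ∧ f w ≤ 1) ∧ (∀ w, 0 < f w → ∀ u, u < w → f u = 1) ∧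
    ∀ u w, 0 < f u → 0 < f w → u ≤ w ∨ w ≤ u

theorem IsTreeFun.inf {f g : W → ℝ} (hf : IsTreeFun f) (hg : IsTreeFun g) :
    IsTreeFun (f ⊓ g) := by
  refine ⟨fun w => ⟨le_inf (hf.1 w).1 (hg.1 w).1, inf_le_left.trans (hf.1 w).2⟩,
    fun w hw u hu => ?_, fun u w hu hw => ?_⟩
  · have hw' := lt_inf_iff.1 hw
    rw [Pi.inf_apply, hf.2.1 w hw'.1 u hu, hg.2.1 w hw'.2 u hu, inf_idem]
  · exact hf.2.2 u w (lt_inf_iff.1 hu).1 (lt_inf_iff.1 hw).1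

variable (W) in
/-- The order of points of a rooted tree, in their description as functions. -/
abbrev TreePoint := {f : W → ℝ // IsTreeFun f}

noncomputable instance : SemilatticeInf (TreePoint W) :=
  Subtype.semilatticeInf (fun {_ _} hf hg => hf.inf hg)

theorem treeLike_treePoint : TreeLike (TreePoint W) := by
  have key : ∀ {f g h : TreePoint W}, f ≤ h → g ≤ h → ∀ u v, f.1 u < g.1 u → g.1 v < f.1 v →
      ¬ u ≤ v := by
    intro f g h hf hg u v hu hv huv
    rcases huv.eq_or_lt with rfl | huv
    · exact lt_asymm hu hv
    · have h1 := f.2.2.1 v ((g.2.1 v).1.trans_lt hv) u huv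
      linarith [(g.2.1 u).2]
  intro f g h hf hg
  by_contra! hcon
  obtain ⟨h1, h2⟩ := hcon
  obtain ⟨v, hv⟩ : ∃ v, g.1 v < f.1 v := by
    by_contra! h'; exact h1 h'
  obtain ⟨u, hu⟩ : ∃ u, f.1 u < g.1 u := by
    by_contra! h'; exact h2 h'
  rcases h.2.2.2 u v ((f.2.1 u).1.trans_lt (hu.trans_le (hg u)))
    ((g.2.1 v).1.trans_lt (hv.trans_le (hf v))) with h' | h'
  · exact key hf hg u v hu hv h'
  · exact key hg hf v u hv hu h'

end TreeFun

section Mass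

variable {W : Type*} [PartialOrder W] [Fintype W]

open Classical in
/-- The total barycentric mass at `w` and below it. -/
noncomputable def massBelow (p : W → ℝ) (w : W) : ℝ :=
  ∑ u, if w ≤ u then p u else 0

theorem continuous_massBelow (w : W) : Continuous fun p : W → ℝ => massBelow p w := by
  unfold massBelow
  refine continuous_finsetSum _ fun u _ => ?_
  split_ifs
  · exact continuous_apply u
  · exact continuous_const

/-- Barycentric coordinates are recovered from the leaves upwards. -/
theorem massBelow_injective : Function.Injective (massBelow : (W → ℝ) → W → ℝ) := by
  classical
  intro p q h
  by_contra hne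
  obtain ⟨w, hw, hmax⟩ := Set.Finite.exists_maximalFor (id : W → W) {w | p w ≠ q w}
    (Set.toFinite _) (Function.ne_iff.1 hne)
  have hmax' : ∀ u, w < u → p u = q u := by
    intro u hu
    by_contra h'
    exact hu.not_ge (hmax h' hu.le)
  apply hw
  have h1 := congrFun h w
  have h2 : massBelow p w - massBelow q w = p w - q w := by
    unfold massBelow
    rw [← Finset.sum_sub_distrib, Finset.sum_eq_single w]
    · simp
    · intro u _ hu
      by_cases hwu : w ≤ u
      · simp [hwu, hmax' u (lt_of_le_of_ne hwu hu.symm)]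
      · simp [hwu]
    · simp
  rw [h1, sub_self] at h2
  linarith

/-- A point of the realization lies between a vertex `c` and its parent `a`. -/
theorem isTreeFun_massBelow (hW : TreeLike W) {p : W → ℝ} (h0 : ∀ w, 0 ≤ p w)
    (h1 : ∑ w, p w = 1) {a c : W} (hac : a ≤ c) (hcov : ∀ u, u < c → u ≤ a)
    (hsupp : ∀ w, p w ≠ 0 → w = a ∨ w = c) : IsTreeFun (massBelow p) := by
  classical
  have hle : ∀ w, 0 < massBelow p w → w ≤ c := by
    intro w hw
    obtain ⟨u, -, hu⟩ := Finset.exists_ne_zero_of_sum_ne_zero (ne_of_gt hw)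
    by_cases hwu : w ≤ u
    · rw [if_pos hwu] at hu
      rcases hsupp u hu with rfl | rfl
      · exact hwu.trans hac
      · exact hwu
    · rw [if_neg hwu] at hu; exact (hu rfl).elim
  have hone : ∀ w, w ≤ a → massBelow p w = 1 := by
    intro w hw
    rw [massBelow, ← h1]
    refine Finset.sum_congr rfl fun u _ => ?_
    by_cases hu : p u = 0
    · simp [hu]
    · rw [if_pos]
      rcases hsupp u hu with rfl | rfl
      · exact hw
      · exact hw.trans hac
  refine ⟨fun w => ⟨?_, ?_⟩, fun w hw u hu => ?_, fun u w hu hw => hW (hle u hu) (hle w hw)⟩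
  · exact Finset.sum_nonneg fun u _ => by split_ifs <;> simp [h0]
  · rw [← h1]
    exact Finset.sum_le_sum fun u _ => by split_ifs <;> simp [h0]
  · exact hone u (hcov u (hu.trans_le (hle w hw)))

/-- A connected set of tree points contains every point of the path from one of its points `a` to
another of its points `b` that lies between the branching point `a ⊓ b` and `a`: otherwise the
edge coordinate at that point would separate the set. -/
theorem exists_eq_of_isPreconnected {X : Type*} [TopologicalSpace X] (D : X → TreePoint W)
    (hD : ∀ w, Continuous fun q => (D q).1 w) {S : Set X} (hS : IsPreconnected S) {a b : X}
    (ha : a ∈ S) (hb : b ∈ S) {f : TreePoint W} (h1 : D a ⊓ D b ≤ f) (h2 : f ≤ D a) :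
    ∃ q ∈ S, D q = f := by
  by_cases hfa : D a = f
  · exact ⟨a, ha, hfa⟩
  have hne : {w | f.1 w < (D a).1 w}.Nonempty := by
    by_contra h
    rw [Set.not_nonempty_iff_eq_empty] at h
    refine hfa (le_antisymm (fun w => not_lt.1 fun hw => ?_) h2)
    have : w ∈ {w | f.1 w < (D a).1 w} := hw
    rw [h] at this
    exact this
  obtain ⟨w, hw, hmin⟩ := Set.Finite.exists_minimalFor (id : W → W) _ (Set.toFinite _) hne
  have hw : f.1 w < (D a).1 w := hw
  have haw : 0 < (D a).1 w := (f.2.1 w).1.trans_lt hw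
  have hfw1 : f.1 w < 1 := hw.trans_le ((D a).2.1 w).2
  have hanc : ∀ u, u < w → f.1 u = 1 := by
    intro u hu
    have : ¬ f.1 u < (D a).1 u := fun h => hu.not_ge (hmin h hu.le)
    exact le_antisymm (f.2.1 u).2 (((D a).2.2.1 w haw u hu) ▸ not_lt.1 this)
  have hinc_a : ∀ u, ¬ u ≤ w → ¬ w ≤ u → (D a).1 u = 0 := by
    intro u h3 h4
    by_contra h
    rcases (D a).2.2.2 u w (lt_of_le_of_ne ((D a).2.1 u).1 (Ne.symm h)) haw with h' | h'
    · exact h3 h'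
    · exact h4 h'
  have hinc : ∀ u, ¬ u ≤ w → ¬ w ≤ u → f.1 u = 0 := fun u h3 h4 =>
    le_antisymm ((hinc_a u h3 h4) ▸ h2 u) (f.2.1 u).1
  have hdesc : ∀ g : TreePoint W, g.1 w < 1 → ∀ u, w < u → g.1 u = 0 := by
    intro g hg u hu
    by_contra h
    exact hg.ne (g.2.2.1 u (lt_of_le_of_ne (g.2.1 u).1 (Ne.symm h)) w hu)
  have hbw : (D b).1 w ≤ f.1 w := by
    have h3 : (D a).1 w ⊓ (D b).1 w ≤ f.1 w := h1 w
    rcases inf_le_iff.1 h3 with h | h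
    · exact absurd hw h.not_gt
    · exact h
  set t : Set X := {q | (D q).1 w ≤ f.1 w} with ht
  set t' : Set X := {q | f.1 w ≤ (D q).1 w} ∩ ({q | ∀ u, u < w → (D q).1 u = 1} ∩
    {q | ∀ u, ¬ u ≤ w → ¬ w ≤ u → (D q).1 u = 0}) with ht'
  have hc : IsClosed t := isClosed_le (hD w) continuous_const
  have hc' : IsClosed t' := by
    refine (isClosed_le continuous_const (hD w)).inter (IsClosed.inter ?_ ?_)
    · simp only [Set.ofPred_forall]
      exact isClosed_iInter fun u => isClosed_iInter fun _ =>
        isClosed_eq (hD u) continuous_const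
    · simp only [Set.ofPred_forall]
      exact isClosed_iInter fun u => isClosed_iInter fun _ => isClosed_iInter fun _ =>
        isClosed_eq (hD u) continuous_const
  have hmem : ∀ q, f.1 w < (D q).1 w → q ∈ t' := by
    intro q hq
    have hpos : 0 < (D q).1 w := (f.2.1 w).1.trans_lt hq
    refine ⟨hq.le, (D q).2.2.1 w hpos, fun u h3 h4 => ?_⟩
    by_contra h
    rcases (D q).2.2.2 u w (lt_of_le_of_ne ((D q).2.1 u).1 (Ne.symm h)) hpos with h' | h'
    · exact h3 h'
    · exact h4 h'
  obtain ⟨q, hqS, hqt, hqt'⟩ := isPreconnected_closed_iff.1 hS t t' hc hc'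
    (fun q _ => (le_or_gt ((D q).1 w) (f.1 w)).imp id (hmem q))
    ⟨b, hb, hbw⟩ ⟨a, ha, hmem a hw⟩
  have hqw : (D q).1 w = f.1 w := le_antisymm hqt hqt'.1
  refine ⟨q, hqS, Subtype.ext (funext fun u => ?_)⟩
  by_cases h3 : u ≤ w
  · rcases h3.eq_or_lt with rfl | h3
    · exact hqw
    · rw [hanc u h3, hqt'.2.1 u h3]
  · by_cases h4 : w ≤ u
    · have h5 : w < u := lt_of_le_of_ne h4 (fun h => h3 h.ge)
      rw [hdesc f hfw1 u h5, hdesc (D q) (hqw ▸ hfw1) u h5]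
    · rw [hinc u h3 h4, hqt'.2.2 u h3 h4]

end Mass

/-! ### Rooting a tree -/

section Root

variable {W : Type*} (T : SimpleGraph W) (r : W)

/-- `u` lies on every walk from the root `r` to `v`. -/
def IsAncestor (u v : W) : Prop := ∀ p : T.Walk r v, u ∈ p.support

variable {T r}

theorem IsAncestor.trans {u v w : W} (huv : IsAncestor T r u v) (hvw : IsAncestor T r v w) :
    IsAncestor T r u w := by
  classical
  intro p
  exact p.support_takeUntil_subset_support (hvw p) (huv (p.takeUntil v (hvw p)))

theorem IsAncestor.antisymm (hT : T.Connected) {u v : W} (huv : IsAncestor T r u v)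
    (hvu : IsAncestor T r v u) : u = v := by
  classical
  by_contra hne
  obtain ⟨p, hp⟩ := hT.exists_walk_length_eq_dist r v
  have h1 := p.length_takeUntil_lt_length (huv p) hne
  have h2 := ((p.takeUntil u (huv p)).length_takeUntil_le_length (hvu _))
  have h3 := SimpleGraph.dist_le ((p.takeUntil u (huv p)).takeUntil v (hvu _))
  omega

theorem IsAncestor.total (hT : T.Connected) {u v w : W} (hu : IsAncestor T r u w)
    (hv : IsAncestor T r v w) : IsAncestor T r u v ∨ IsAncestor T r v u := by
  classical
  -- a walk to `u` that misses `v` forces every walk from `u` to `w` through `v`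
  by_contra! h
  obtain ⟨h1, h2⟩ := h
  have key : ∀ {u v : W}, ¬ IsAncestor T r v u → IsAncestor T r v w → T.dist v w < T.dist u w := by
    intro u v h hv
    simp only [IsAncestor, not_forall] at h
    obtain ⟨q, hq⟩ := h
    obtain ⟨s, hs⟩ := hT.exists_walk_length_eq_dist u w
    have h3 := hv (q.append s)
    rw [SimpleGraph.Walk.mem_support_append_iff] at h3
    have h4 := h3.resolve_left hq
    have h5 : u ≠ v := by
      rintro rfl
      exact hq q.end_mem_support
    have h6 := s.length_dropUntil_lt_length h4 h5.symm
    have h7 := SimpleGraph.dist_le (s.dropUntil v h4)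
    omega
  exact lt_asymm (key h1 hu) (key h2 hv)

variable (r) in
/-- The order of the vertices of a tree seen from the root `r`. -/
@[reducible] def rootOrder (hT : T.Connected) : PartialOrder W where
  le := IsAncestor T r
  le_refl _ p := p.end_mem_support
  le_trans _ _ _ := IsAncestor.trans
  le_antisymm _ _ := IsAncestor.antisymm hT

/-- Of two adjacent vertices of a rooted tree, one is the parent of the other. -/
theorem IsAncestor.of_adj (hT : T.IsTree) {a b : W} (hab : T.Adj a b)
    (h : ¬ IsAncestor T r b a) :
    IsAncestor T r a b ∧ ∀ u, IsAncestor T r u b → u ≠ b → IsAncestor T r u a := by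
  classical
  simp only [IsAncestor, not_forall] at h
  obtain ⟨q, hq⟩ := h
  refine ⟨fun p => ?_, fun u hu hne p => ?_⟩
  · have hpath : (q.bypass.concat hab).IsPath :=
      q.bypass_isPath.concat (fun h => hq (q.support_bypass_subset_support h)) hab
    have h1 := (hT.existsUnique_path r b).unique p.bypass_isPath hpath
    have h2 : a ∈ p.bypass.support := by
      rw [h1, SimpleGraph.Walk.support_concat]
      simp
    exact p.support_bypass_subset_support h2
  · have h1 := hu (p.concat hab)
    rw [SimpleGraph.Walk.support_concat] at h1
    simpa [hne] using h1

end Root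

/-- The map `D` into an order describes a topological tree: a connected set contains every point
of the path from one of its points `a` to the branching point of the root paths of `a` and
another of its points. -/
structure IsTreeOrder {X P : Type*} [TopologicalSpace X] [SemilatticeInf P] (D : X → P) :
    Prop where
  treeLike : TreeLike P
  injective : Function.Injective D
  exists_eq : ∀ {S : Set X}, IsPreconnected S → ∀ {a b : X}, a ∈ S → b ∈ S →
    ∀ {f : P}, D a ⊓ D b ≤ f → f ≤ D a → ∃ q ∈ S, D q = f

/-- The realization of a finite tree, rooted at a vertex, is described by a tree-like order. -/
theorem exists_isTreeOrder.{u} {W : Type u} [Fintype W] (T : SimpleGraph W) (hT : T.IsTree) :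
    ∃ (P : Type u) (_ : SemilatticeInf P) (D : Realization T → P), IsTreeOrder D := by
  obtain ⟨r⟩ := hT.connected.nonempty
  let := rootOrder r hT.connected
  have hW : TreeLike W := fun _ _ _ h1 h2 => IsAncestor.total hT.connected h1 h2
  have hD : ∀ p : Realization T, IsTreeFun (massBelow p.1) := by
    rintro ⟨p, h0, h1, a, b, hab, hsupp⟩
    rcases hab with rfl | hab
    · exact isTreeFun_massBelow hW h0 h1 le_rfl (fun u hu => hu.le) hsupp
    · by_cases h : IsAncestor T r b a
      · have h' : ¬ IsAncestor T r a b := fun h' => hab.ne (h'.antisymm hT.connected h)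
        obtain ⟨h2, h3⟩ := IsAncestor.of_adj hT hab.symm h'
        exact isTreeFun_massBelow hW h0 h1 h2 (fun u hu => h3 u hu.le hu.ne)
          (fun w hw => (hsupp w hw).symm)
      · obtain ⟨h2, h3⟩ := IsAncestor.of_adj hT hab h
        exact isTreeFun_massBelow hW h0 h1 h2 (fun u hu => h3 u hu.le hu.ne) hsupp
  refine ⟨TreePoint W, inferInstance, fun p => ⟨massBelow p.1, hD p⟩, treeLike_treePoint,
    fun p q h => Subtype.ext (massBelow_injective (congrArg Subtype.val h)), ?_⟩
  intro S hS a b ha hb f h1 h2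
  exact exists_eq_of_isPreconnected (fun p : Realization T => (⟨massBelow p.1, hD p⟩ : TreePoint W))
    (fun w => (continuous_massBelow w).comp continuous_subtype_val) hS ha hb h1 h2

/-- A pinned induced subgraph gives a representation of every finite family of its vertices,
where repeated vertices count as adjacent. -/
theorem IsTreeOrder.exists_pinnedRep {R P V I Γ : Type*} [TopologicalSpace R] [SemilatticeInf P]
    [Finite I] {D : R → P} (hD : IsTreeOrder D) {G : SimpleGraph V} {X : Set V} {x : V → R}
    (h : IsPinned (G.induce X) (fun v : X => x v)) (z : I → V) (hz : ∀ i, z i ∈ X)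
    (c : V → Γ) (pt : Γ → R) (hc : ∀ v, pt (c v) = x v) :
    Nonempty (PinnedRep (fun i j => z i = z j ∨ G.Adj (z i) (z j)) (c ∘ z) (D ∘ pt)) := by
  obtain ⟨S, ⟨hS, hadj⟩, hx⟩ := h
  refine PinnedChordal.exists_pinnedRep hD.treeLike _ _ _ (fun i => D '' S ⟨z i, hz i⟩) ?_ ?_ ?_
  · rintro i _ ⟨a, ha, rfl⟩ _ ⟨b, hb, rfl⟩ f h1 h2
    exact hD.exists_eq (hS _).isPreconnected ha hb h1 h2
  · intro i
    refine ⟨_, hx ⟨z i, hz i⟩, ?_⟩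
    simp [hc]
  · intro i j
    rw [← Set.image_inter hD.injective, Set.image_nonempty]
    by_cases hij : z i = z j
    · have h2 : (⟨z i, hz i⟩ : X) = ⟨z j, hz j⟩ := Subtype.ext hij
      rw [h2, Set.inter_self]
      exact iff_of_true (Or.inl hij) (hS _).nonempty
    · rw [← hadj _ _ (fun h2 => hij (congrArg Subtype.val h2))]
      simp [hij]

/-- A graph that is pinned on its whole vertex set is chordal. -/
theorem IsTreeOrder.isChordal {R P V : Type*} [TopologicalSpace R] [SemilatticeInf P] [Finite V]
    {D : R → P} (hD : IsTreeOrder D) {G : SimpleGraph V} {x : V → R}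
    (h : IsPinned (G.induce Set.univ) (fun v : (Set.univ : Set V) => x v)) : IsChordal G := by
  obtain ⟨ρ⟩ := hD.exists_pinnedRep h id (fun v => Set.mem_univ v) x id (fun _ => rfl)
  refine isChordal_of_isRootedSubtree hD.treeLike ρ.t ρ.S ρ.sub G fun u v huv => ?_
  rw [← ρ.adj]
  simp [huv]

/-! ### Exchange arguments and sampling -/

open Finset in
/-- For a uniformly random bijection `π` of the index set, the element `π b` is witnessed by the
sample `π ∘ y` except with probability at most `|Γ| / (|J| + 1)`: exchanging `b` with the positions
of the sample, at most one element with each pin is not witnessed by the others. -/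
theorem card_perm_not_isWitnessed_le {I J Γ : Type*} [Fintype I] [DecidableEq I] [Fintype J]
    [Fintype Γ] (x : I → Γ) (C : I → I → Prop) (R : I → I → I → Prop)
    (hR : ∀ u v w, x v = x w → C u v → C u w → R u v w ∨ R u w v) (a b : I) (y : J → I)
    (hy : Function.Injective y) (ha : ∀ j, y j ≠ a) (hb : ∀ j, y j ≠ b) (hab : a ≠ b) :
    (Fintype.card J + 1) *
        {π : Equiv.Perm I | ¬ IsWitnessed x (C (π a)) (R (π a)) (π ∘ y) (π b)}.ncard ≤
      Fintype.card Γ * Fintype.card (Equiv.Perm I) := by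
  classical
  set B : Equiv.Perm I → Prop := fun π => ¬ IsWitnessed x (C (π a)) (R (π a)) (π ∘ y) (π b)
    with hB
  let o : Option J → I := fun i => i.elim b y
  have h1 : ∀ i, (univ.filter fun π => B (π * Equiv.swap b (o i))).card = (univ.filter B).card := by
    intro i
    refine card_bij' (fun π _ => π * Equiv.swap b (o i)) (fun π _ => π * Equiv.swap b (o i))
      ?_ ?_ ?_ ?_
    · intro π hπ; simpa using hπ
    · intro π hπ; simpa [mul_assoc] using hπ
    · intro π _; simp [mul_assoc]
    · intro π _; simp [mul_assoc]
  have h2 : ∀ π, (univ.filter fun i => B (π * Equiv.swap b (o i))).card ≤ Fintype.card Γ := by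
    intro π
    refine card_le_card_of_injOn (fun i => x (π (o i))) (fun _ _ => mem_univ _) ?_
    have hpos : ∀ i i' : Option J, i ≠ i' → ∃ j, (π * Equiv.swap b (o i)) (y j) = π (o i') := by
      intro i i' hii
      rcases i' with _ | j'
      · rcases i with _ | j
        · exact (hii rfl).elim
        · exact ⟨j, by simp [o]⟩
      · refine ⟨j', ?_⟩
        have : y j' ≠ o i := by
          rcases i with _ | j
          · exact hb j'
          · exact fun h => hii (by rw [hy h])
        simp [Equiv.swap_apply_of_ne_of_ne (hb j') this, o]
    have hlast : ∀ i, (π * Equiv.swap b (o i)) b = π (o i) := by intro i; simp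
    have hfirst : ∀ i, (π * Equiv.swap b (o i)) a = π a := by
      intro i
      have : a ≠ o i := by
        rcases i with _ | j
        · exact hab
        · exact (ha j).symm
      simp [Equiv.swap_apply_of_ne_of_ne hab this]
    have hunf : ∀ i i', B (π * Equiv.swap b (o i)) → i ≠ i' → x (π (o i)) = x (π (o i')) →
        C (π a) (π (o i)) ∧ (C (π a) (π (o i')) → ¬ R (π a) (π (o i')) (π (o i))) := by
      intro i i' hi hii hx
      simp only [hB, IsWitnessed, hlast, hfirst] at hi
      push Not at hi
      refine ⟨hi.1, fun hc => ?_⟩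
      obtain ⟨j, hj⟩ := hpos i i' hii
      have := hi.2 j
      simp only [Function.comp, hj] at this
      exact this hx.symm hc
    intro i hi i' hi' hx
    by_contra hii
    simp only [coe_filter, mem_univ, true_and, Set.mem_ofPred_eq] at hi hi'
    obtain ⟨c1, r1⟩ := hunf i i' hi hii hx
    obtain ⟨c2, r2⟩ := hunf i' i hi' (Ne.symm hii) hx.symm
    rcases hR (π a) _ _ hx c1 c2 with h | h
    · exact r2 c1 h
    · exact r1 c2 h
  have h3 : {π | B π}.ncard = (univ.filter B).card := by
    rw [← Set.ncard_coe_finset]; simp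
  rw [h3]
  calc (Fintype.card J + 1) * (univ.filter B).card
      = ∑ i : Option J, (univ.filter fun π => B (π * Equiv.swap b (o i))).card := by
        simp [h1]
    _ = ∑ π : Equiv.Perm I, (univ.filter fun i => B (π * Equiv.swap b (o i))).card := by
        simp only [card_filter]
        exact sum_comm
    _ ≤ ∑ _π : Equiv.Perm I, Fintype.card Γ := sum_le_sum fun π _ => h2 π
    _ = Fintype.card Γ * Fintype.card (Equiv.Perm I) := by simp [mul_comm]

open Finset in
/-- Lower tail of a binomial distribution, from the expectation of `2 ^ (-count)`. -/
theorem card_few_hits_le {Ω : Type*} [Fintype Ω] (B : Set Ω) (q a : ℝ)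
    (hB : q * Fintype.card Ω ≤ B.ncard) (t : ℕ) :
    ({p : Fin t → Ω | ({i | p i ∈ B}.ncard : ℝ) ≤ a}.ncard : ℝ) ≤
      2 ^ a * ((1 - q / 2) * Fintype.card Ω) ^ t := by
  classical
  set f : Ω → ℝ := fun w => if w ∈ B then 1 / 2 else 1 with hf
  have hf0 : ∀ w, 0 ≤ f w := fun w => by simp only [hf]; split_ifs <;> norm_num
  have hsum : ∑ w, f w ≤ (1 - q / 2) * Fintype.card Ω := by
    have h1 : ∑ w, f w = Fintype.card Ω - (B.ncard : ℝ) / 2 := by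
      have h2 : ∀ w, f w = 1 - (if w ∈ B then (1 : ℝ) else 0) / 2 := fun w => by
        simp only [hf]; split_ifs <;> norm_num
      rw [sum_congr rfl fun w _ => h2 w, sum_sub_distrib, ← sum_div, sum_boole]
      congr 2
      · simp
      · rw [← Set.ncard_coe_finset]; simp
    rw [h1]; linarith
  have hprod : ∀ p : Fin t → Ω, ∏ i, f (p i) = (2 : ℝ)⁻¹ ^ {i | p i ∈ B}.ncard := by
    intro p
    simp only [hf]
    rw [prod_ite, prod_const, prod_const_one, mul_one, one_div]
    congr 1
    rw [← Set.ncard_coe_finset]; simp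
  have hind : ∀ p : Fin t → Ω, (if ({i | p i ∈ B}.ncard : ℝ) ≤ a then (1 : ℝ) else 0) ≤
      2 ^ a * ∏ i, f (p i) := by
    intro p
    split_ifs with h
    · rw [hprod, inv_pow, ← Real.rpow_natCast, ← div_eq_mul_inv, one_le_div (by positivity)]
      exact Real.rpow_le_rpow_of_exponent_le (by norm_num) h
    · exact mul_nonneg (by positivity) (prod_nonneg fun i _ => hf0 _)
  have hcard : ({p : Fin t → Ω | ({i | p i ∈ B}.ncard : ℝ) ≤ a}.ncard : ℝ) =
      ∑ p : Fin t → Ω, if ({i | p i ∈ B}.ncard : ℝ) ≤ a then (1 : ℝ) else 0 := by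
    rw [sum_boole, ← Set.ncard_coe_finset]; simp
  rw [hcard]
  calc _ ≤ ∑ p : Fin t → Ω, 2 ^ a * ∏ i, f (p i) := sum_le_sum fun p _ => hind p
    _ = 2 ^ a * (∑ w, f w) ^ t := by
        rw [← mul_sum, ← Fintype.piFinset_univ, ← prod_univ_sum]; simp
    _ ≤ _ := by
        refine mul_le_mul_of_nonneg_left (pow_le_pow_left₀ (sum_nonneg fun w _ => hf0 w) hsum t)
          (by positivity)

theorem exists_perm_map_eq {V : Type*} [Finite V] {X Y : Finset V} (h : X.card = Y.card) :
    ∃ τ : Equiv.Perm V, X.map τ.toEmbedding = Y := by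
  classical
  have e : {a // a ∈ X} ≃ {a // a ∈ Y} := Fintype.equivOfCardEq (by simpa using h)
  refine ⟨e.extendSubtype, Finset.eq_of_subset_of_card_le ?_ (by simp [h])⟩
  intro w hw
  obtain ⟨v, hv, rfl⟩ := Finset.mem_map.1 hw
  exact e.extendSubtype_mem v hv

open Finset in
/-- If a property `Q` of sets passes to the families of their elements as `Z`, then a random
`m`-element set has property `Q` with at most the probability that a random family, indexed
by a set of size at most `m`, has property `Z`. -/
theorem card_subsets_mul_le {V I : Type*} [Fintype V] [Fintype I] {m : ℕ}
    (hI : Fintype.card I ≤ m) (hm : m ≤ Fintype.card V) (Q : Finset V → Prop)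
    (Z : (I → V) → Prop) (h : ∀ X, Q X → ∀ z : I → V, (∀ i, z i ∈ X) → Z z) :
    {X : Finset V | X.card = m ∧ Q X}.ncard * Fintype.card V ^ Fintype.card I ≤
      {X : Finset V | X.card = m}.ncard * {z | Z z}.ncard := by
  classical
  set F : Finset V → ℕ := fun X => (univ.filter fun σ : Equiv.Perm V =>
    Q (X.map σ.toEmbedding)).card with hF
  have hconst : ∀ X Y : Finset V, X.card = Y.card → F X = F Y := by
    intro X Y hXY
    obtain ⟨τ, rfl⟩ := exists_perm_map_eq hXY
    refine card_bij' (fun σ _ => σ * τ⁻¹) (fun σ _ => σ * τ) ?_ ?_ ?_ ?_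
    · intro σ hσ
      simp only [mem_filter, mem_univ, true_and] at hσ ⊢
      rw [map_map]
      convert hσ using 2
      ext v; simp
    · intro σ hσ
      simp only [mem_filter, mem_univ, true_and] at hσ ⊢
      rw [map_map] at hσ
      exact hσ
    · intro σ _; simp
    · intro σ _; simp
  obtain ⟨X₀, -, hX₀⟩ := exists_subset_card_eq (s := (univ : Finset V)) (n := m) (by simpa using hm)
  have hz : ∀ z : I → V, F X₀ ≤ (univ.filter fun σ : Equiv.Perm V => Z (σ ∘ z)).card := by
    intro z
    obtain ⟨X, hX, hXm⟩ := exists_superset_card_eq (s := univ.image z)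
      (card_image_le.trans (by simpa using hI)) hm
    rw [hconst X₀ X (hX₀.trans hXm.symm)]
    refine card_le_card fun σ hσ => ?_
    simp only [mem_filter, mem_univ, true_and] at hσ ⊢
    exact h _ hσ _ fun i => mem_map_of_mem _ (hX (mem_image_of_mem _ (mem_univ i)))
  have hZ : ∀ σ : Equiv.Perm V,
      (univ.filter fun z : I → V => Z (σ ∘ z)).card = (univ.filter Z).card := by
    intro σ
    refine card_bij' (fun z _ => σ ∘ z) (fun z _ => σ.symm ∘ z) ?_ ?_ ?_ ?_
    · intro z hz; simpa using hz
    · intro z hz; simpa [← Function.comp_assoc] using hz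
    · intro z _; simp [← Function.comp_assoc]
    · intro z _; simp [← Function.comp_assoc]
  have hQ : ∀ σ : Equiv.Perm V, (univ.filter fun X : Finset V => X.card = m ∧
      Q (X.map σ.toEmbedding)).card = (univ.filter fun X : Finset V => X.card = m ∧ Q X).card := by
    intro σ
    refine card_bij' (fun X _ => X.map σ.toEmbedding) (fun X _ => X.map σ.symm.toEmbedding)
      ?_ ?_ ?_ ?_
    · intro X hX; simpa using hX
    · intro X hX; simpa [map_map] using hX
    · intro X _; simp [map_map]
    · intro X _; simp [map_map]
  have e1 : {X : Finset V | X.card = m ∧ Q X}.ncard =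
      (univ.filter fun X : Finset V => X.card = m ∧ Q X).card := by
    rw [← Set.ncard_coe_finset]; simp
  have e2 : {X : Finset V | X.card = m}.ncard =
      (univ.filter fun X : Finset V => X.card = m).card := by
    rw [← Set.ncard_coe_finset]; congr 1; ext X; simp
  have e3 : {z | Z z}.ncard = (univ.filter Z).card := by
    rw [← Set.ncard_coe_finset]; simp
  rw [e1, e2, e3]
  set n' := Fintype.card (Equiv.Perm V) with hn'
  have hn'pos : 0 < n' := Fintype.card_pos
  have s1 : (univ.filter fun X : Finset V => X.card = m).card * F X₀ =
      n' * (univ.filter fun X : Finset V => X.card = m ∧ Q X).card := by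
    calc _ = ∑ X ∈ univ.filter (fun X : Finset V => X.card = m), F X := by
          rw [← smul_eq_mul, ← sum_const]
          refine sum_congr rfl fun X hX => hconst _ _ ?_
          rw [hX₀, (mem_filter.1 hX).2]
      _ = ∑ σ : Equiv.Perm V, (univ.filter fun X : Finset V => X.card = m ∧
            Q (X.map σ.toEmbedding)).card := by
          simp only [hF, card_filter]
          rw [sum_comm]
          refine sum_congr rfl fun σ _ => ?_
          rw [sum_filter]
          refine sum_congr rfl fun X _ => ?_
          by_cases h1 : X.card = m <;> simp [h1]
      _ = _ := by simp [hQ, hn']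
  have s2 : Fintype.card V ^ Fintype.card I * F X₀ ≤ n' * (univ.filter Z).card := by
    calc _ = ∑ _z : I → V, F X₀ := by simp
      _ ≤ ∑ z : I → V, (univ.filter fun σ : Equiv.Perm V => Z (σ ∘ z)).card :=
          sum_le_sum fun z _ => hz z
      _ = ∑ σ : Equiv.Perm V, (univ.filter fun z : I → V => Z (σ ∘ z)).card := by
          simp only [card_filter]; exact sum_comm
      _ = _ := by simp [hZ, hn']
  refine Nat.le_of_mul_le_mul_left ?_ hn'pos
  calc n' * ((univ.filter fun X : Finset V => X.card = m ∧ Q X).card *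
        Fintype.card V ^ Fintype.card I)
      = (univ.filter fun X : Finset V => X.card = m).card *
          (Fintype.card V ^ Fintype.card I * F X₀) := by rw [← mul_assoc, ← s1]; ring
    _ ≤ (univ.filter fun X : Finset V => X.card = m).card * (n' * (univ.filter Z).card) := by
        gcongr
    _ = _ := by ring

/-! ### Predicting a graph from a sample -/

section Predict

variable {V J Γ : Type*} (G : SimpleGraph V) (c : V → Γ) (y : J → V)
  (d : SamplePoint J Γ → SamplePoint J Γ → Prop)

/-- Adjacency or equality; a family of vertices with repetitions is treated as a graph in which
copies of a vertex are adjacent. -/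
def AdjOrEq (u v : V) : Prop := u = v ∨ G.Adj u v

/-- The prediction for `u` and `v`, given their pins and their adjacency to the sample `y`. -/
def Predicted (u v : V) : Prop :=
  PredictedAdj d (c ∘ y) (c u) {j | AdjOrEq G u (y j)} (c v) {j | AdjOrEq G v (y j)}

/-- The graph on all vertices that is predicted from the sample `y`. -/
def predictedGraph : SimpleGraph V where
  Adj u v := u ≠ v ∧ Predicted G c y d u v
  symm := ⟨fun _ _ h => ⟨h.1.symm, (predictedAdj_comm _ _ _ _ _ _).1 h.2⟩⟩
  loopless := ⟨fun _ h => h.1 rfl⟩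

/-- The pairs at which the prediction is wrong. -/
def mispredicted : Set (V × V) :=
  {w | ¬ (Predicted G c y d w.1 w.2 ↔ AdjOrEq G w.1 w.2)}

/-- A chordal prediction is wrong at many pairs if the graph is far from chordal. -/
theorem le_ncard_mispredicted [Fintype V] {ε : ℝ} (hG : ¬ IsCloseToChordal ε G)
    (hd : IsChordal (predictedGraph G c y d)) :
    ε * Fintype.card (V × V) ≤ (mispredicted G c y d).ncard := by
  have h1 : ε * (Fintype.card V : ℝ) ^ 2 ≤
      ((symmDiff G.edgeSet (predictedGraph G c y d).edgeSet).ncard : ℝ) := by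
    by_contra h
    exact hG ⟨_, hd, not_le.1 h⟩
  have h2 : symmDiff G.edgeSet (predictedGraph G c y d).edgeSet ⊆
      (fun w : V × V => s(w.1, w.2)) '' mispredicted G c y d := by
    intro e
    induction e using Sym2.ind with
    | _ u v =>
      intro he
      refine ⟨(u, v), ?_, rfl⟩
      simp only [Set.mem_symmDiff, SimpleGraph.mem_edgeSet, predictedGraph] at he
      simp only [mispredicted, AdjOrEq, Set.mem_ofPred_eq]
      rcases he with ⟨h3, h4⟩ | ⟨h3, h4⟩
      · have := h3.ne
        tauto
      · tauto
  have h3 := (Set.ncard_le_ncard h2 (Set.toFinite _)).trans (Set.ncard_image_le (Set.toFinite _))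
  rw [Fintype.card_prod]
  push_cast
  rw [← pow_two]
  exact h1.trans (by exact_mod_cast h3)

/-- Some order of the distinguished points predicts a chordal graph that is wrong at few of
the test pairs `p`. -/
def HasGoodPrediction {t : ℕ} (ε : ℝ) (p : Fin t → V × V) : Prop :=
  ∃ d, IsChordal (predictedGraph G c y d) ∧
    ({i | p i ∈ mispredicted G c y d}.ncard : ℝ) ≤ ε / 4 * t

end Predict

open Finset in
/-- For a graph far from chordal, a union bound over all orders of the distinguished points: good
predictions are rare. -/
theorem card_hasGoodPrediction_le {V Γ : Type*} [Fintype V] [Fintype Γ] {G : SimpleGraph V}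
    {ε : ℝ} (hε : ε ≤ 1) (hG : ¬ IsCloseToChordal ε G) (c : V → Γ) {s t M : ℕ}
    (hM : s + (s + 1) * Fintype.card Γ ≤ M)
    (hbound : (2 : ℝ) ^ (M ^ 2) * (2 ^ (ε / 4 * t) * (1 - ε / 2) ^ t) ≤ 1 / 4) :
    4 * ({w : (Fin s → V) × (Fin t → V × V) | HasGoodPrediction G c w.1 ε w.2}.ncard : ℝ) ≤
      (Fintype.card V : ℝ) ^ (s + 2 * t) := by
  classical
  let D := SamplePoint (Fin s) Γ → SamplePoint (Fin s) Γ → Prop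
  have hD : (Fintype.card D : ℝ) ≤ 2 ^ (M ^ 2) := by
    have h1 : Fintype.card (SamplePoint (Fin s) Γ) ≤ M := by
      refine le_trans (le_of_eq ?_) hM
      simp
    have h2 : Fintype.card D = (2 ^ Fintype.card (SamplePoint (Fin s) Γ)) ^
        Fintype.card (SamplePoint (Fin s) Γ) := by
      simp only [D, Fintype.card_pi, prod_const, Fintype.card_prop, card_univ]
    rw [h2, ← pow_mul, ← pow_two]
    push_cast
    exact pow_le_pow_right₀ (by norm_num) (Nat.pow_le_pow_left h1 2)
  have hone : ∀ y : Fin s → V, ∀ d : D, ((univ.filter fun p : Fin t → V × V =>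
      IsChordal (predictedGraph G c y d) ∧
        ({i | p i ∈ mispredicted G c y d}.ncard : ℝ) ≤ ε / 4 * t).card : ℝ) ≤
      2 ^ (ε / 4 * t) * ((1 - ε / 2) ^ t * (Fintype.card V ^ 2) ^ t) := by
    intro y d
    by_cases hd : IsChordal (predictedGraph G c y d)
    · have h1 := card_few_hits_le (mispredicted G c y d) ε (ε / 4 * t)
        (le_ncard_mispredicted G c y d hG hd) t
      rw [← mul_pow, pow_two]
      rw [Fintype.card_prod] at h1
      push_cast at h1
      refine le_trans (le_of_eq ?_) h1
      rw [← Set.ncard_coe_finset]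
      simp [hd]
    · have h2 : 0 ≤ 1 - ε / 2 := by linarith
      simp only [hd, false_and, filter_false, card_empty, Nat.cast_zero]
      positivity
  set K : ℝ := 2 ^ (ε / 4 * t) * ((1 - ε / 2) ^ t * ((Fintype.card V : ℝ) ^ 2) ^ t) with hK
  have hfib : ∀ y : Fin s → V, ((univ.filter fun p : Fin t → V × V =>
      HasGoodPrediction G c y ε p).card : ℝ) ≤ Fintype.card D * K := by
    intro y
    have h1 : (univ.filter fun p : Fin t → V × V => HasGoodPrediction G c y ε p) =
        univ.biUnion fun d : D => univ.filter fun p : Fin t → V × V =>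
          IsChordal (predictedGraph G c y d) ∧
            ({i | p i ∈ mispredicted G c y d}.ncard : ℝ) ≤ ε / 4 * t := by
      ext p
      simp only [mem_filter, mem_biUnion, mem_univ, true_and]
      rfl
    rw [h1]
    refine le_trans (Nat.cast_le.2 card_biUnion_le) ?_
    push_cast
    exact (sum_le_sum fun d _ => hone y d).trans (by simp)
  have hsum : ({w : (Fin s → V) × (Fin t → V × V) | HasGoodPrediction G c w.1 ε w.2}.ncard : ℝ) =
      ∑ y : Fin s → V, ((univ.filter fun p : Fin t → V × V =>
        HasGoodPrediction G c y ε p).card : ℝ) := by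
    have h1 : {w : (Fin s → V) × (Fin t → V × V) | HasGoodPrediction G c w.1 ε w.2}.ncard =
        (univ.filter fun w : (Fin s → V) × (Fin t → V × V) =>
          HasGoodPrediction G c w.1 ε w.2).card := by
      rw [← Set.ncard_coe_finset]; simp
    rw [h1]
    simp only [card_filter]
    push_cast
    rw [Fintype.sum_prod_type]
  have hK0 : 0 ≤ K := by
    have h2 : 0 ≤ 1 - ε / 2 := by linarith
    positivity
  rw [hsum]
  calc 4 * ∑ y : Fin s → V, ((univ.filter fun p : Fin t → V × V =>
        HasGoodPrediction G c y ε p).card : ℝ)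
      ≤ 4 * ∑ _y : Fin s → V, (2 : ℝ) ^ (M ^ 2) * K := by
        gcongr with y
        exact (hfib y).trans (by gcongr)
    _ = 4 * ((2 : ℝ) ^ (M ^ 2) * (2 ^ (ε / 4 * t) * (1 - ε / 2) ^ t)) *
          (Fintype.card V : ℝ) ^ (s + 2 * t) := by
        simp only [sum_const, card_univ, Fintype.card_fun, Fintype.card_fin, nsmul_eq_mul, hK]
        push_cast
        rw [pow_add, pow_mul]
        ring
    _ ≤ 4 * (1 / 4) * (Fintype.card V : ℝ) ^ (s + 2 * t) := by gcongr
    _ = _ := by ring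

/-! ### Families that admit a representation -/

/-- The indices of a sample of size `s` and of `t` test pairs. -/
abbrev SampleIndex (s t : ℕ) := Fin s ⊕ (Fin t × Bool)

section Family

variable {V Γ P : Type*} [PartialOrder P] {G : SimpleGraph V} {c : V → Γ} {e : Γ → P} {s t : ℕ}

/-- The test pairs of a family of vertices. -/
def testPairs (z : SampleIndex s t → V) (i : Fin t) : V × V :=
  (z (Sum.inr (i, false)), z (Sum.inr (i, true)))

/-- The family of vertices `z` has a representation with the prescribed pins. -/
def IsRepresentable (G : SimpleGraph V) (c : V → Γ) (e : Γ → P) (z : SampleIndex s t → V) : Prop :=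
  Nonempty (PinnedRep (fun i j => AdjOrEq G (z i) (z j)) (c ∘ z) e)

theorem not_isWellSampled_of_mispredicted (hP : TreeLike P) {z : SampleIndex s t → V}
    (ρ : PinnedRep (fun i j => AdjOrEq G (z i) (z j)) (c ∘ z) e)
    (π : Equiv.Perm (SampleIndex s t)) (i : Fin t)
    (h : testPairs (z ∘ π) i ∈ mispredicted G c (z ∘ π ∘ Sum.inl) (ρ.order (π ∘ Sum.inl))) :
    ¬ (ρ.IsWellSampled (π ∘ Sum.inl) (π (Sum.inr (i, false))) (π (Sum.inr (i, true))) ∧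
      ρ.IsWellSampled (π ∘ Sum.inl) (π (Sum.inr (i, true))) (π (Sum.inr (i, false)))) :=
  fun hw => h (ρ.predictedAdj_iff_adj hP (π ∘ Sum.inl) hw.1 hw.2)

theorem mul_ncard_not_le {α : Type*} [Finite α] {p q r w : α → Prop} {n K : ℕ}
    (h : ∀ a, p a → q a → r a → w a) (hp : n * {a | ¬ p a}.ncard ≤ K)
    (hq : n * {a | ¬ q a}.ncard ≤ K) (hr : n * {a | ¬ r a}.ncard ≤ K) :
    n * {a | ¬ w a}.ncard ≤ 3 * K := by
  have hsub : {a | ¬ w a} ⊆ {a | ¬ p a} ∪ ({a | ¬ q a} ∪ {a | ¬ r a}) := fun a ha => by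
    by_contra hcon
    rw [Set.mem_union, Set.mem_union, not_or, not_or] at hcon
    exact ha (h a (not_not.1 hcon.1) (not_not.1 hcon.2.1) (not_not.1 hcon.2.2))
  have h4 := (Set.ncard_le_ncard hsub (Set.toFinite _)).trans ((Set.ncard_union_le _ _).trans
    (Nat.add_le_add_left (Set.ncard_union_le _ _) _))
  calc _ ≤ _ := Nat.mul_le_mul_left _ h4
    _ ≤ _ := by rw [mul_add, mul_add]; linarith

theorem card_perm_not_isWellSampled_le [Fintype Γ] (hP : TreeLike P) {z : SampleIndex s t → V}
    (ρ : PinnedRep (fun i j => AdjOrEq G (z i) (z j)) (c ∘ z) e) (a b : Fin t × Bool)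
    (hab : a ≠ b) :
    (s + 1) * {π : Equiv.Perm (SampleIndex s t) |
        ¬ ρ.IsWellSampled (π ∘ Sum.inl) (π (Sum.inr a)) (π (Sum.inr b))}.ncard ≤
      3 * (Fintype.card Γ * Fintype.card (Equiv.Perm (SampleIndex s t))) := by
  have key := fun C R hR => card_perm_not_isWitnessed_le (c ∘ z) C R hR (Sum.inr a) (Sum.inr b)
    (Sum.inl : Fin s → SampleIndex s t) Sum.inl_injective (by simp) (by simp) (by simpa using hab)
  have h1 := key (fun u w => ¬ ρ.t w ≤ ρ.b u ((c ∘ z) w)) (fun _ w w' => ρ.t w ≤ ρ.t w')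
    (fun u v w hvw _ _ => hP (ρ.t_le v) (hvw ▸ ρ.t_le w))
  have h2 := key (fun u w => AdjOrEq G (z u) (z w))
    (fun u w w' => ρ.b w ((c ∘ z) u) ≤ ρ.b w' ((c ∘ z) u))
    (fun u v w _ _ _ => hP (ρ.b_le v _) (ρ.b_le w _))
  have h3 := key (fun u w => ρ.t w ≤ e ((c ∘ z) u)) (fun _ w w' => ρ.t w' ≤ ρ.t w)
    (fun u v w _ hv hw => hP hw hv)
  rw [Fintype.card_fin] at h1 h2 h3
  exact mul_ncard_not_le (fun π => PinnedRep.IsWellSampled.mk) h1 h2 h3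

theorem card_perm_mispredicted_le [Fintype Γ] (hP : TreeLike P) {z : SampleIndex s t → V}
    (ρ : PinnedRep (fun i j => AdjOrEq G (z i) (z j)) (c ∘ z) e) (i : Fin t) :
    (s + 1) * {π : Equiv.Perm (SampleIndex s t) | testPairs (z ∘ π) i ∈
        mispredicted G c (z ∘ π ∘ Sum.inl) (ρ.order (π ∘ Sum.inl))}.ncard ≤
      6 * (Fintype.card Γ * Fintype.card (Equiv.Perm (SampleIndex s t))) := by
  have h1 := card_perm_not_isWellSampled_le hP ρ (i, false) (i, true) (by simp)
  have h2 := card_perm_not_isWellSampled_le hP ρ (i, true) (i, false) (by simp)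
  have hsub : {π : Equiv.Perm (SampleIndex s t) | testPairs (z ∘ π) i ∈
      mispredicted G c (z ∘ π ∘ Sum.inl) (ρ.order (π ∘ Sum.inl))} ⊆
      {π | ¬ ρ.IsWellSampled (π ∘ Sum.inl) (π (Sum.inr (i, false))) (π (Sum.inr (i, true)))} ∪
      {π | ¬ ρ.IsWellSampled (π ∘ Sum.inl) (π (Sum.inr (i, true))) (π (Sum.inr (i, false)))} :=
    fun π hπ => not_and_or.1 (not_isWellSampled_of_mispredicted hP ρ π i hπ)
  have h3 := (Set.ncard_le_ncard hsub (Set.toFinite _)).trans (Set.ncard_union_le _ _)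
  calc _ ≤ _ := Nat.mul_le_mul_left _ h3
    _ ≤ _ := by rw [mul_add]; linarith

open Finset in
/-- At least half of the rearrangements of a representable family have a good prediction, by
Markov's inequality for the number of mispredicted test pairs. -/
theorem card_perm_le_two_mul [Fintype Γ] (hP : TreeLike P) {ε : ℝ} (hε : 0 < ε) (ht : 0 < t)
    (hs : 48 * Fintype.card Γ ≤ ε * (s + 1)) {z : SampleIndex s t → V}
    (hz : IsRepresentable G c e z) :
    Fintype.card (Equiv.Perm (SampleIndex s t)) ≤
      2 * {π : Equiv.Perm (SampleIndex s t) |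
        HasGoodPrediction G c ((z ∘ π) ∘ Sum.inl) ε (testPairs (z ∘ π))}.ncard := by
  classical
  obtain ⟨ρ⟩ := hz
  set n' := Fintype.card (Equiv.Perm (SampleIndex s t)) with hn'
  set M : Fin t → Equiv.Perm (SampleIndex s t) → Prop := fun i π => testPairs (z ∘ π) i ∈
    mispredicted G c (z ∘ π ∘ Sum.inl) (ρ.order (π ∘ Sum.inl)) with hM
  have h1 : ∀ i, ((univ.filter (M i)).card : ℝ) ≤ ε / 8 * n' := by
    intro i
    have h2 := card_perm_mispredicted_le hP ρ i
    have h3 : {π | M i π}.ncard = (univ.filter (M i)).card := by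
      rw [← Set.ncard_coe_finset]; simp
    change (s + 1) * {π | M i π}.ncard ≤ _ at h2
    rw [h3] at h2
    have h4 : ((s : ℝ) + 1) * (univ.filter (M i)).card ≤ 6 * (Fintype.card Γ * n') := by
      exact_mod_cast h2
    have h5 : ((s : ℝ) + 1) * (univ.filter (M i)).card ≤ (s + 1) * (ε / 8 * n') := by
      refine h4.trans ?_
      have : (0 : ℝ) ≤ n' := Nat.cast_nonneg _
      nlinarith [mul_le_mul_of_nonneg_right hs this]
    exact le_of_mul_le_mul_left h5 (by positivity)
  set few : Equiv.Perm (SampleIndex s t) → Prop := fun π =>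
    ((univ.filter fun i => M i π).card : ℝ) ≤ ε / 4 * t with hfew
  have h2 : ε / 4 * t * (univ.filter fun π => ¬ few π).card ≤ t * (ε / 8 * n') := by
    calc ε / 4 * t * (univ.filter fun π => ¬ few π).card
        = ∑ π ∈ univ.filter (fun π => ¬ few π), ε / 4 * t := by
          rw [sum_const, nsmul_eq_mul, mul_comm]
      _ ≤ ∑ π ∈ univ.filter (fun π => ¬ few π), ((univ.filter fun i => M i π).card : ℝ) :=
          sum_le_sum fun π hπ => (not_le.1 (mem_filter.1 hπ).2).le
      _ ≤ ∑ π, ((univ.filter fun i => M i π).card : ℝ) :=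
          sum_le_sum_of_subset_of_nonneg (filter_subset _ _) fun _ _ _ => Nat.cast_nonneg _
      _ = ∑ i, ((univ.filter (M i)).card : ℝ) := by
          simp only [card_filter]
          push_cast
          exact sum_comm
      _ ≤ ∑ _i : Fin t, ε / 8 * n' := sum_le_sum fun i _ => h1 i
      _ = t * (ε / 8 * n') := by simp
  have h3 : 2 * ((univ.filter fun π => ¬ few π).card : ℝ) ≤ n' := by
    have : (0 : ℝ) < t := Nat.cast_pos.2 ht
    have h4 : ε / 8 * t * (2 * ((univ.filter fun π => ¬ few π).card : ℝ)) ≤ ε / 8 * t * n' := by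
      linarith
    exact le_of_mul_le_mul_left h4 (by positivity)
  have h4 : 2 * (univ.filter fun π => ¬ few π).card ≤ n' := by exact_mod_cast h3
  have h5 : (univ.filter few).card + (univ.filter fun π => ¬ few π).card = n' := by
    rw [card_filter_add_card_filter_not, card_univ]
  have h6 : (univ.filter few).card ≤ {π : Equiv.Perm (SampleIndex s t) |
      HasGoodPrediction G c ((z ∘ π) ∘ Sum.inl) ε (testPairs (z ∘ π))}.ncard := by
    rw [← Set.ncard_coe_finset]
    refine Set.ncard_le_ncard (fun π hπ => ?_) (Set.toFinite _)
    have hπ' : few π := by simpa using hπ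
    refine ⟨ρ.order (π ∘ Sum.inl), ?_, ?_⟩
    · exact ρ.isChordal_predicted hP (π ∘ Sum.inl) (c ∘ z ∘ π ∘ Sum.inl) c
        (fun v => {j | AdjOrEq G v (z (π (Sum.inl j)))}) _
        fun u v huv => ⟨fun h => h.2, fun h => ⟨huv, h⟩⟩
    · refine le_trans (le_of_eq ?_) hπ'
      rw [← Set.ncard_coe_finset]
      simp [hM, Function.comp_assoc]
  omega

open Finset in
/-- A family of random vertices of a graph far from chordal is representable with probability at
most one half. -/
theorem card_isRepresentable_le [Fintype V] [Fintype Γ] (hP : TreeLike P) {ε : ℝ} (hε : 0 < ε)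
    (hε1 : ε ≤ 1) (hG : ¬ IsCloseToChordal ε G) (ht : 0 < t)
    (hs : 48 * Fintype.card Γ ≤ ε * (s + 1)) {M : ℕ} (hM : s + (s + 1) * Fintype.card Γ ≤ M)
    (hbound : (2 : ℝ) ^ (M ^ 2) * (2 ^ (ε / 4 * t) * (1 - ε / 2) ^ t) ≤ 1 / 4) :
    2 * {z : SampleIndex s t → V | IsRepresentable G c e z}.ncard ≤
      Fintype.card V ^ Fintype.card (SampleIndex s t) := by
  classical
  set n' := Fintype.card (Equiv.Perm (SampleIndex s t)) with hn'
  have hn'pos : 0 < n' := Fintype.card_pos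
  set E : (SampleIndex s t → V) → Prop := fun z =>
    HasGoodPrediction G c (z ∘ Sum.inl) ε (testPairs z) with hE
  set Z : (SampleIndex s t → V) → Prop := IsRepresentable G c e with hZ
  have h1 : ∀ z, Z z → n' ≤ 2 * (univ.filter fun π : Equiv.Perm (SampleIndex s t) =>
      E (z ∘ π)).card := by
    intro z hz
    have h := card_perm_le_two_mul hP hε ht hs hz
    rw [← Set.ncard_coe_finset]
    simpa using h
  have h2 : ∀ π : Equiv.Perm (SampleIndex s t),
      (univ.filter fun z : SampleIndex s t → V => E (z ∘ π)).card = (univ.filter E).card := by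
    intro π
    refine card_bij' (fun z _ => z ∘ π) (fun z _ => z ∘ π.symm) ?_ ?_ ?_ ?_
    · intro z hz; simpa using hz
    · intro z hz; simpa [Function.comp_assoc] using hz
    · intro z _; simp [Function.comp_assoc]
    · intro z _; simp [Function.comp_assoc]
  have h3 : n' * (univ.filter Z).card ≤ n' * (2 * (univ.filter E).card) := by
    calc n' * (univ.filter Z).card = ∑ _z ∈ univ.filter Z, n' := by
          rw [sum_const, smul_eq_mul, mul_comm]
      _ ≤ ∑ z ∈ univ.filter Z, 2 * (univ.filter fun π : Equiv.Perm (SampleIndex s t) =>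
            E (z ∘ π)).card := sum_le_sum fun z hz => h1 z (mem_filter.1 hz).2
      _ ≤ ∑ z, 2 * (univ.filter fun π : Equiv.Perm (SampleIndex s t) => E (z ∘ π)).card :=
          sum_le_sum_of_subset (filter_subset _ _)
      _ = 2 * ∑ π : Equiv.Perm (SampleIndex s t),
            (univ.filter fun z : SampleIndex s t → V => E (z ∘ π)).card := by
          rw [← mul_sum]
          simp only [card_filter]
          rw [sum_comm]
      _ = _ := by simp only [h2, sum_const, card_univ, smul_eq_mul, hn']; ring
  have h4 := Nat.le_of_mul_le_mul_left h3 hn'pos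
  have h5 : (univ.filter E).card ≤
      {w : (Fin s → V) × (Fin t → V × V) | HasGoodPrediction G c w.1 ε w.2}.ncard := by
    rw [← Set.ncard_coe_finset]
    refine Set.ncard_le_ncard_of_injOn (fun z => (z ∘ Sum.inl, testPairs z)) ?_ ?_ (Set.toFinite _)
    · intro z hz
      simpa [hE] using hz
    · intro z _ z' _ h
      have ha := congrArg Prod.fst h
      have hb := congrArg Prod.snd h
      funext i
      rcases i with j | ⟨j, _ | _⟩
      · exact congrFun ha j
      · exact congrArg Prod.fst (congrFun hb j)
      · exact congrArg Prod.snd (congrFun hb j)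
  have h6 := card_hasGoodPrediction_le hε1 hG c hM hbound
  have h7 : 4 * {w : (Fin s → V) × (Fin t → V × V) | HasGoodPrediction G c w.1 ε w.2}.ncard ≤
      Fintype.card V ^ (s + 2 * t) := by exact_mod_cast h6
  have h8 : Fintype.card (SampleIndex s t) = s + 2 * t := by simp [mul_comm]
  have h9 : {z | Z z}.ncard = (univ.filter Z).card := by
    rw [← Set.ncard_coe_finset]; simp
  change 2 * {z | Z z}.ncard ≤ _
  rw [h8, h9]
  omega

end Family

/-! ### The sample size -/

/-- With `M = 3 s k` and `L = s² k²`, the union bound runs over `2 ^ (M ^ 2) = 2 ^ (9 L)` orders; it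
is beaten by `t ≥ 44 L / ε` test pairs. -/
theorem union_bound_le {ε : ℝ} (hε1 : ε ≤ 1) {L t : ℕ} (hL : 1 ≤ L)
    (ht : 44 * (L : ℝ) ≤ ε * t) :
    (2 : ℝ) ^ (9 * L) * (2 ^ (ε / 4 * t) * (1 - ε / 2) ^ t) ≤ 1 / 4 := by
  have hL' : (1 : ℝ) ≤ L := by exact_mod_cast hL
  have h2e : (2 : ℝ) ≤ Real.exp 1 := by have := Real.add_one_le_exp (1 : ℝ); linarith
  have h1 : (2 : ℝ) ^ (9 * L) ≤ Real.exp (9 * L) := by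
    calc (2 : ℝ) ^ (9 * L) ≤ Real.exp 1 ^ (9 * L) := by gcongr
      _ = Real.exp (9 * L) := by rw [← Real.exp_nat_mul]; push_cast; ring_nf
  have h2 : (2 : ℝ) ^ (ε / 4 * t) ≤ Real.exp (ε / 4 * t) := by
    calc (2 : ℝ) ^ (ε / 4 * t) ≤ Real.exp 1 ^ (ε / 4 * t) :=
          Real.rpow_le_rpow (by norm_num) h2e (by linarith)
      _ = _ := by rw [← Real.exp_mul, one_mul]
  have h3 : (1 - ε / 2) ^ t ≤ Real.exp (-(ε / 2 * t)) := by
    calc (1 - ε / 2) ^ t ≤ Real.exp (-(ε / 2)) ^ t := by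
          refine pow_le_pow_left₀ (by linarith) ?_ t
          have := Real.add_one_le_exp (-(ε / 2)); linarith
      _ = _ := by rw [← Real.exp_nat_mul]; congr 1; ring
  have h4 : (0 : ℝ) ≤ (1 - ε / 2) ^ t := pow_nonneg (by linarith) t
  calc (2 : ℝ) ^ (9 * L) * (2 ^ (ε / 4 * t) * (1 - ε / 2) ^ t)
      ≤ Real.exp (9 * L) * (Real.exp (ε / 4 * t) * Real.exp (-(ε / 2 * t))) := by gcongr
    _ = Real.exp (9 * L - ε * t / 4) := by rw [← Real.exp_add, ← Real.exp_add]; congr 1; ring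
    _ ≤ Real.exp (-2) := by gcongr; linarith
    _ = (Real.exp 1 * Real.exp 1)⁻¹ := by rw [Real.exp_neg, ← Real.exp_add]; norm_num
    _ ≤ 1 / 4 := by
        rw [one_div]
        refine inv_anti₀ (by norm_num) ?_
        nlinarith

/-- The number of sampled vertices needed by the union bound is of order `k ^ 4 / ε ^ 3`. -/
theorem exists_sample_parameters {ε : ℝ} (hε : 0 < ε) (hε1 : ε ≤ 1) {k g : ℕ} (hk : 2 ≤ k)
    (hg : g ≤ k) : ∃ s t M : ℕ, 0 < t ∧ 48 * (g : ℝ) ≤ ε * (s + 1) ∧ s + (s + 1) * g ≤ M ∧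
      (2 : ℝ) ^ (M ^ 2) * (2 ^ (ε / 4 * t) * (1 - ε / 2) ^ t) ≤ 1 / 4 ∧
      s + 2 * t ≤ ⌈queryBound ε k⌉₊ := by
  have hk' : (2 : ℝ) ≤ k := by exact_mod_cast hk
  have hg' : (g : ℝ) ≤ k := by exact_mod_cast hg
  set s := ⌈48 * k / ε⌉₊ with hs
  set t := ⌈44 * ((s ^ 2 * k ^ 2 : ℕ) : ℝ) / ε⌉₊ with ht
  have hs1 : 48 * k / ε ≤ s := Nat.le_ceil _
  have hs2 : (s : ℝ) < 48 * k / ε + 1 := Nat.ceil_lt_add_one (by positivity)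
  have ht1 : 44 * ((s ^ 2 * k ^ 2 : ℕ) : ℝ) / ε ≤ t := Nat.le_ceil _
  have ht2 : (t : ℝ) < 44 * ((s ^ 2 * k ^ 2 : ℕ) : ℝ) / ε + 1 :=
    Nat.ceil_lt_add_one (by positivity)
  have hspos : 0 < s := Nat.ceil_pos.2 (by positivity)
  have hL : 1 ≤ s ^ 2 * k ^ 2 := Nat.one_le_iff_ne_zero.2 (by positivity)
  have hLpos : (0 : ℝ) < ((s ^ 2 * k ^ 2 : ℕ) : ℝ) := by exact_mod_cast hL
  refine ⟨s, t, 3 * s * k, Nat.ceil_pos.2 (by positivity), ?_, ?_, ?_, ?_⟩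
  · rw [div_le_iff₀ hε] at hs1
    nlinarith
  · calc s + (s + 1) * g ≤ s + (s + 1) * k := by gcongr
      _ ≤ 3 * s * k := by nlinarith [Nat.mul_le_mul hspos (le_refl k)]
  · rw [show (3 * s * k) ^ 2 = 9 * (s ^ 2 * k ^ 2) by ring]
    refine union_bound_le hε1 hL ?_
    rw [div_le_iff₀ hε] at ht1
    linarith
  · have hinv : 1 ≤ ε⁻¹ := (one_le_inv₀ hε).2 hε1
    set r := ε⁻¹ with hr
    have hkr : 1 ≤ k * r := by nlinarith
    have hs3 : (s : ℝ) ≤ 49 * (k * r) := by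
      rw [div_eq_mul_inv] at hs2; nlinarith
    have ht3 : (t : ℝ) ≤ 44 * (49 ^ 2 * k ^ 4 * r ^ 3) + 1 := by
      refine ht2.le.trans ?_
      rw [div_eq_mul_inv]
      push_cast
      have h1 : (s : ℝ) ^ 2 ≤ (49 * (k * r)) ^ 2 := by gcongr
      have h2 : 44 * ((s : ℝ) ^ 2 * k ^ 2) * r ≤ 44 * ((49 * (k * r)) ^ 2 * k ^ 2) * r := by
        gcongr
      nlinarith
    have hX : k * r ≤ k ^ 4 * r ^ 3 := by
      have h1 : (k : ℝ) ^ 1 ≤ k ^ 4 := pow_le_pow_right₀ (by linarith) (by norm_num)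
      have h2 : r ^ 1 ≤ r ^ 3 := pow_le_pow_right₀ hinv (by norm_num)
      rw [pow_one] at h1 h2
      gcongr
    have hN : ((s + 2 * t : ℕ) : ℝ) ≤ 2 ^ 18 * (k ^ 4 * r ^ 3) := by
      push_cast
      nlinarith
    have hlog : 1 / 2 ≤ Real.log k :=
      le_trans (by have := Real.log_two_gt_d9; linarith) (Real.log_le_log (by norm_num) hk')
    have hq : 2 ^ 18 * (k ^ 4 * r ^ 3) ≤ queryBound ε k := by
      have h1 : (k : ℝ) ^ 4 ≤ k ^ 6 := pow_le_pow_right₀ (by linarith) (by norm_num)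
      have h2 : r ^ 3 ≤ r ^ 4 := pow_le_pow_right₀ hinv (by norm_num)
      have h3 : (1 / 2) ^ 4 ≤ Real.log k ^ 4 := by gcongr
      have h4 : (k : ℝ) ^ 4 * r ^ 3 ≤ k ^ 6 * r ^ 4 := by gcongr
      have h5 : (0 : ℝ) ≤ k ^ 6 * r ^ 4 := by positivity
      calc 2 ^ 18 * (k ^ 4 * r ^ 3) ≤ 2 ^ 40 * (k ^ 6 * r ^ 4) * (1 / 2) ^ 4 := by
            nlinarith
        _ ≤ 2 ^ 40 * (k ^ 6 * r ^ 4) * Real.log k ^ 4 := by gcongr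
        _ = queryBound ε k := by rw [queryBound, ← inv_pow]; ring
    exact Nat.cast_le.1 ((hN.trans hq).trans (Nat.le_ceil _))

theorem isChordal_bot {V : Type*} : IsChordal (⊥ : SimpleGraph V) := by
  intro k hk
  refine ⟨fun f => ?_⟩
  obtain ⟨n, rfl⟩ : ∃ n, k = n + 2 := ⟨k - 2, by omega⟩
  have h : (SimpleGraph.cycleGraph (n + 2)).Adj 1 0 := by
    rw [SimpleGraph.cycleGraph_adj]; simp
  exact (SimpleGraph.bot_adj _ _).1 (f.map_rel_iff.2 h)

theorem isCloseToChordal_of_isChordal {V : Type*} [Fintype V] [Nonempty V] {ε : ℝ} (hε : 0 < ε)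
    {G : SimpleGraph V} (hG : IsChordal G) : IsCloseToChordal ε G := by
  refine ⟨G, hG, ?_⟩
  have : (0 : ℝ) < Fintype.card V := Nat.cast_pos.2 Fintype.card_pos
  simp only [symmDiff_self, Set.bot_eq_empty, Set.ncard_empty, Nat.cast_zero]
  positivity

theorem isCloseToChordal_of_one_le {V : Type*} [Fintype V] [Nonempty V] {ε : ℝ} (hε : 1 ≤ ε)
    (G : SimpleGraph V) : IsCloseToChordal ε G := by
  classical
  refine ⟨⊥, isChordal_bot, ?_⟩
  have hn : 0 < Fintype.card V := Fintype.card_pos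
  have h1 : (symmDiff G.edgeSet (⊥ : SimpleGraph V).edgeSet).ncard ≤ (Fintype.card V).choose 2 := by
    have h2 : symmDiff G.edgeSet (⊥ : SimpleGraph V).edgeSet = (G.edgeFinset : Set (Sym2 V)) := by
      simp [← Set.bot_eq_empty]
    rw [h2, Set.ncard_coe_finset]
    exact G.card_edgeFinset_le_card_choose_two
  have h3 : (Fintype.card V).choose 2 < Fintype.card V ^ 2 := by
    rw [Nat.choose_two_right]
    refine (Nat.div_le_self _ _).trans_lt ?_
    rw [pow_two]
    exact Nat.mul_lt_mul_of_pos_left (by omega) hn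
  have h4 : ((symmDiff G.edgeSet (⊥ : SimpleGraph V).edgeSet).ncard : ℝ) <
      (Fintype.card V : ℝ) ^ 2 := by exact_mod_cast h1.trans_lt h3
  have : (0 : ℝ) ≤ (Fintype.card V : ℝ) ^ 2 := by positivity
  nlinarith

/-- A property of probability at most one half fails with probability at least one half. -/
theorem half_le_subsetProb_not {V : Type*} [Fintype V] {m : ℕ} (hm : m ≤ Fintype.card V)
    (Q : Finset V → Prop)
    (h : 2 * {X : Finset V | X.card = m ∧ Q X}.ncard ≤ {X : Finset V | X.card = m}.ncard) :
    1 / 2 ≤ subsetProb m (fun X => ¬ Q X) := by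
  obtain ⟨X₀, -, hX₀⟩ := Finset.exists_subset_card_eq (s := (Finset.univ : Finset V)) (n := m)
    (by simpa using hm)
  have hpos : 0 < {X : Finset V | X.card = m}.ncard :=
    (Set.ncard_pos (Set.toFinite _)).2 ⟨X₀, hX₀⟩
  have h1 : {X : Finset V | X.card = m} ⊆
      {X : Finset V | X.card = m ∧ Q X} ∪ {X : Finset V | X.card = m ∧ ¬ Q X} := fun X hX =>
    (em (Q X)).imp (fun h => ⟨hX, h⟩) (fun h => ⟨hX, h⟩)
  have h2 := (Set.ncard_le_ncard h1 (Set.toFinite _)).trans (Set.ncard_union_le _ _)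
  have hpos' : (0 : ℝ) < ({X : Finset V | X.card = m}.ncard : ℝ) := by exact_mod_cast hpos
  rw [subsetProb, le_div_iff₀ hpos']
  have h3 : {X : Finset V | X.card = m}.ncard ≤ 2 * {X : Finset V | X.card = m ∧ ¬ Q X}.ncard := by
    omega
  have h4 : ({X : Finset V | X.card = m}.ncard : ℝ) ≤
      2 * ({X : Finset V | X.card = m ∧ ¬ Q X}.ncard : ℝ) := by exact_mod_cast h3
  linarith

end PinnedChordal

theorem mainTheorem3 (ε : ℝ) (hε : 0 < ε) (k : ℕ) (hk : 2 ≤ k)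
    {W : Type*} [Fintype W] (T : SimpleGraph W) (hT : T.IsTree)
    (hleaves : (PinnedChordal.leaves T).ncard ≤ k)
    (Γ₀ : Finset (PinnedChordal.Realization T)) (hΓ₀ : Γ₀.card ≤ k)
    {V : Type*} [Fintype V] [Nonempty V] (G : SimpleGraph V)
    (x : V → PinnedChordal.Realization T) (hx : ∀ v, x v ∈ Γ₀) :
    PinnedChordal.IsCloseToChordal ε G ∨
      1 / 2 ≤ PinnedChordal.subsetProb (PinnedChordal.sampleSize V ε k)
        (fun X : Finset V =>
          ¬ PinnedChordal.IsPinned (G.induce (X : Set V))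
            (fun v : (X : Set V) => x (v : V))) := by
  open PinnedChordal in
  classical
  refine or_iff_not_imp_left.2 fun hG => ?_
  have hε1 : ε ≤ 1 := not_lt.1 fun h => hG (isCloseToChordal_of_one_le h.le G)
  obtain ⟨P, _, D, hD⟩ := exists_isTreeOrder T hT
  have hm : sampleSize V ε k ≤ Fintype.card V := min_le_right _ _
  refine half_le_subsetProb_not hm _ ?_
  by_cases hV : Fintype.card V ≤ ⌈queryBound ε k⌉₊
  · -- the sample is the whole graph, and a pinned graph is chordal
    have hempty : {X : Finset V | X.card = sampleSize V ε k ∧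
        IsPinned (G.induce (X : Set V)) (fun v : (X : Set V) => x (v : V))} = ∅ := by
      refine Set.eq_empty_of_forall_notMem fun X hX => ?_
      obtain ⟨hX1, hX2⟩ := hX
      rw [sampleSize, min_eq_right hV, Finset.card_eq_iff_eq_univ] at hX1
      subst hX1
      rw [Finset.coe_univ] at hX2
      exact hG (isCloseToChordal_of_isChordal hε (hD.isChordal hX2))
    rw [hempty, Set.ncard_empty]
    exact Nat.zero_le _
  · obtain ⟨s, t, M, ht, hs, hM, hbound, hN⟩ :=
      exists_sample_parameters hε hε1 hk (g := Fintype.card Γ₀) (by simpa using hΓ₀)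
    have hsize : sampleSize V ε k = ⌈queryBound ε k⌉₊ := min_eq_left (not_le.1 hV).le
    have hI : Fintype.card (SampleIndex s t) ≤ sampleSize V ε k := by
      rw [hsize]
      refine le_trans (le_of_eq ?_) hN
      simp [mul_comm]
    let c : V → Γ₀ := fun v => ⟨x v, hx v⟩
    have h1 := card_subsets_mul_le hI hm
      (fun X => IsPinned (G.induce (X : Set V)) (fun v : (X : Set V) => x (v : V)))
      (IsRepresentable G c (D ∘ Subtype.val) : (SampleIndex s t → V) → Prop)
      (fun X hX z hz => hD.exists_pinnedRep hX z hz c Subtype.val fun _ => rfl)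
    have h2 := card_isRepresentable_le (c := c) (e := D ∘ (Subtype.val : Γ₀ → Realization T))
      hD.treeLike hε hε1 hG ht hs hM hbound
    have hpos : 0 < Fintype.card V ^ Fintype.card (SampleIndex s t) :=
      Nat.pow_pos Fintype.card_pos
    refine Nat.le_of_mul_le_mul_right (c := Fintype.card V ^ Fintype.card (SampleIndex s t)) ?_ hpos
    calc _ = 2 * (_ * Fintype.card V ^ Fintype.card (SampleIndex s t)) := mul_assoc _ _ _
      _ ≤ 2 * _ := Nat.mul_le_mul_left 2 h1
      _ = _ * (2 * _) := by ring
      _ ≤ _ := Nat.mul_le_mul_left _ h2
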